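/- **Setting.** Let $m\ge 1$, $n\ge 1$, $r\ge 0$ be integers and $\bar n=n-1$. Symmetric tensors $F$ of order $m$ over $\mathbb{C}^n$ carry the Hilbert–Schmidt norm and are also indexed by $\alpha\in\mathbb{N}^{\bar n}$, $|\alpha|\le m$, through $F_\alpha=F_{i_1\dots i_m}$ whenever $x^\alpha=x_{i_1-1}\cdots x_{i_m-1}$, $x_0=1$. Let $\mathbb{B}_0$ be the set of the first $r$ monomials in the graded lexicographic list $1,x_1,\dots,x_{\bar n},x_1^2,x_1x_2,\dots$, and $\mathbb{B}_1=(\mathbb{B}_0\cup x_1\mathbb{B}_0\cup\dots\cup x_{\bar n}\mathbb{B}_0)\setminus\mathbb{B}_0$. For $\alpha\in\mathbb{B}_1$ let $A[F,\alpha]=(F_{\beta+\gamma})_{\gamma,\beta}$ and $b[F,\alpha]=(F_{\alpha+\gamma})_\gamma$, where $|\gamma|\le m-|\alpha|$ and $\beta\in\mathbb{B}_0$. For $G\in\mathbb{C}^{\mathbb{B}_0\times\mathbb{B}_1}$ the companion matrix $M_{x_k}(G)\in\mathbb{C}^{\mathbb{B}_0\times\mathbb{B}_0}$ has $(\mu,\nu)$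 entry $1$ if $\nu+e_k\in\mathbb{B}_0$ and $\mu=\nu+e_k$, $0$ if $\nu+e_k\in\mathbb{B}_0$ and $\mu\neq\nu+e_k$, and $G(\mu,\nu+e_k)$ if $\nu+e_k\in\mathbb{B}_1$. **Algorithm** (input $F$, $r$). 1. Take $G^{ls}$ minimizing $\sum_{\alpha\in\mathbb{B}_1}\|A[F,\alpha]G(:,\alpha)-b[F,\alpha]\|^2$ and, among all minimizers, minimizing $\sum_{k<l}\|[M_{x_k}(G),M_{x_l}(G)]\|_F^2$. 2. Take a unit eigenvector $\hat\xi$ for the smallest eigenvalue of $\hat V=\sum_k V_k^*V_k$, where $V_k$ has the columns $\mathrm{vec}[M_{x_k}(G^{ls}),M_{x_l}(G^{ls})]$, $l=1,\dots,\bar n$, and a Schur decomposition $\hat Q^*L(\hat\xi)\hat Q=\hat T$ of $L(\hat\xi)=\sum_k\hat\xi_kM_{x_k}(G^{ls})$, with $\hat Q=[\hat q_1\cdots\hat q_r]$ unitary and $\hat T$ upper triangular. 3. Put $v_i^{ls}=(\hat q_i^*M_{x_k}(G^{ls})\hat q_i)_{k=1}^{\bar n}$ and let $\lambda^{ls}\in\mathbb{C}^r$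 minimize $\|\sum_i\lambda_i(1,v_i^{ls})^{\otimes m}-F\|^2$. 4. Put $u_i^{ls}=\sqrt[m]{\lambda_i^{ls}}\,(1,v_i^{ls})$ (any $m$-th root) and $X^{gp}=\sum_i(u_i^{ls})^{\otimes m}$. 5. Improve $(u_i^{ls})$ by finitely many steps of a descent method (one that never increases the objective) for $\min\|\sum_iu_i^{\otimes m}-F\|^2$; let $X^{opt}=\sum_i(u_i^{opt})^{\otimes m}$ be given by the last iterate. **Reference approximation.** Let $u_1^{bs},\dots,u_r^{bs}\in\mathbb{C}^n$ have nonzero first entries, $X^{bs}=\sum_i(u_i^{bs})^{\otimes m}$ and $\varepsilon=\|F-X^{bs}\|$ (in particular, $X^{bs}$ may be a best or nearly best rank-$r$ approximation of $F$). Write $u_i^{bs}=(\lambda_i^{bs})^{1/m}(1,v_i^{bs})$. The tuple $(u_i^{bs})$ is *scaling-optimal* for $F$ if $\lambda^{bs}$ minimizes $\|\sum_i\lambda_i(1,v_i^{bs})^{\otimes m}-F\|^2$ over $\lambda\in\mathbb{C}^r$. Consider the conditions: (i) the vectors $[v_1^{bs}]_{\mathbb{B}_0},\dots,[v_r^{bs}]_{\mathbb{B}_0}$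 of the monomials in $\mathbb{B}_0$ evaluated at $v_i^{bs}$ are linearly independent; (ii) every $A[F,\alpha]$, $\alpha\in\mathbb{B}_1$, has full column rank; (iii) $(u_1^{bs},\dots,u_r^{bs})$ is scaling-optimal for $F$; (iv) $L(\hat\xi)$ has no repeated eigenvalue. **Theorem.** (a) For every symmetric $F$ with (ii) there are $\delta,C>0$, depending only on $F$ (and $m,n,r$), such that for every run of the algorithm on $F$ with (iv) and every tuple $(u_i^{bs})$ with nonzero first entries, (i), (iii) and $\varepsilon\le\delta$, $$\|X^{bs}-X^{gp}\|\le C\varepsilon,\qquad \|F-X^{opt}\|\le\|F-X^{gp}\|\le C\varepsilon .$$ (b) The constants are moreover uniform over well-conditioned data: for every $\kappa>0$ there are $\delta,C>0$, depending only on $m,n,r,\kappa$, such that the same estimates hold for every symmetric $F$ with (ii), $\|F\|\le\kappa$ and $\|g\|\le\kappa\|A[F,\alpha]g\|$ for all $\alpha\in\mathbb{B}_1$ and $g\in\mathbb{C}^{\mathbb{B}_0}$, every run of the algorithm on $F$ with (iv) in which any two distinct eigenvalues $a,b$ of $L(\hat\xi)$ satisfy $\kappa|a-b|\ge1$, and every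 tuple $(u_i^{bs})$ with nonzero first entries, (i), (iii) and $\varepsilon\le\delta$. -/

import Mathlib

open scoped Matrix

noncomputable section

namespace LowRank

/-! ### Tensors

`Tensor m d` is the space of tensors of order `m` over `ℂ ^ n` with `n = d + 1`, with the
Hilbert-Schmidt norm. The index `0 : Fin (d + 1)` is the first coordinate of `ℂ ^ n`. -/

/-- Order `m` tensors over `ℂ ^ (d + 1)` with the Hilbert-Schmidt norm. -/
abbrev Tensor (m d : ℕ) : Type := EuclideanSpace ℂ (Fin m → Fin (d + 1))

/-- The entries are invariant under all permutations of the indices. -/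
def IsSymmetric {m d : ℕ} (F : Tensor m d) : Prop :=
  ∀ (σ : Equiv.Perm (Fin m)) (i : Fin m → Fin (d + 1)), F (i ∘ σ) = F i

/-- The tensor power `u ^ {⊗ m}`. -/
def tpow (m : ℕ) {d : ℕ} (u : Fin (d + 1) → ℂ) : Tensor m d :=
  WithLp.toLp 2 fun i => ∏ j, u (i j)

/-- The tensor `u_1 ^ {⊗ m} + ⋯ + u_r ^ {⊗ m}`. -/
def waring (m : ℕ) {d r : ℕ} (u : Fin r → Fin (d + 1) → ℂ) : Tensor m d :=
  ∑ i, tpow m (u i)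

/-- The vector `(1, v)`. -/
def homog {d : ℕ} (v : Fin d → ℂ) : Fin (d + 1) → ℂ := Fin.cons 1 v

/-- The tensor `∑ i, lam_i (1, v_i) ^ {⊗ m}`. -/
def scaledSum (m : ℕ) {d r : ℕ} (lam : Fin r → ℂ) (v : Fin r → Fin d → ℂ) : Tensor m d :=
  ∑ i, lam i • tpow m (homog (v i))

/-! ### Indexing by monomial powers -/

/-- Exponents `α` of monomials `x ^ α` in `x_1, …, x_d`. -/
abbrev Expo (d : ℕ) : Type := Fin d → ℕ

/-- The total degree `|α|`. -/
def deg {d : ℕ} (α : Expo d) : ℕ := ∑ k, α k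

/-- The monomial `x ^ α` evaluated at `v`. -/
def monomialAt {d : ℕ} (v : Fin d → ℂ) (α : Expo d) : ℂ := ∏ k, v k ^ α k

/-- The exponent of the monomial `x_{i_1} ⋯ x_{i_m}`, where `x_0 = 1`. -/
def expoOf {m d : ℕ} (i : Fin m → Fin (d + 1)) : Expo d :=
  fun k => (Finset.univ.filter fun j => i j = k.succ).card

open Classical in
/-- `F_α := F_{i_1 … i_m}` whenever `x ^ α = x_{i_1} ⋯ x_{i_m}` (with `x_0 = 1`); for symmetric `F`
it does not depend on the chosen tuple, see `entry_eq`. Such a tuple exists if `|α| ≤ m`,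
see `exists_expoOf`. -/
def entry {m d : ℕ} (F : Tensor m d) (α : Expo d) : ℂ :=
  if h : ∃ i : Fin m → Fin (d + 1), expoOf i = α then F h.choose else 0

lemma fiber_zero_add {m d : ℕ} (i : Fin m → Fin (d + 1)) :
    (Finset.univ.filter fun j => i j = 0).card + deg (expoOf i) = m := by
  have h := Finset.card_eq_sum_card_fiberwise (s := (Finset.univ : Finset (Fin m)))
    (t := (Finset.univ : Finset (Fin (d + 1)))) (f := i) (by intro x _; simp)
  rw [Fin.sum_univ_succ] at h
  simpa [deg, expoOf] using h.symm

lemma entry_eq {m d : ℕ} {F : Tensor m d} (hF : IsSymmetric F) (i : Fin m → Fin (d + 1)) :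
    entry F (expoOf i) = F i := by
  have hex : ∃ i' : Fin m → Fin (d + 1), expoOf i' = expoOf i := ⟨i, rfl⟩
  rw [entry, dif_pos hex]
  have hi := hex.choose_spec
  generalize hex.choose = i' at hi ⊢
  have hcard : ∀ k : Fin (d + 1), Fintype.card {j // i' j = k} = Fintype.card {j // i j = k} := by
    intro k
    rw [Fintype.card_subtype, Fintype.card_subtype]
    refine Fin.cases ?_ (fun k => congrFun hi k) k
    have h1 := fiber_zero_add i
    have h2 := fiber_zero_add i'
    rw [hi] at h2
    omega
  let e : ∀ k : Fin (d + 1), {j // i' j = k} ≃ {j // i j = k} :=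
    fun k => Fintype.equivOfCardEq (hcard k)
  let σ : Equiv.Perm (Fin m) :=
    ((Equiv.sigmaFiberEquiv i').symm.trans (Equiv.sigmaCongrRight e)).trans
      (Equiv.sigmaFiberEquiv i)
  have hσ : i ∘ σ = i' := by
    funext j
    exact (e (i' j) ⟨j, rfl⟩).2
  rw [← hσ]
  exact hF σ i

lemma exists_expoOf {m d : ℕ} {α : Expo d} (h : deg α ≤ m) :
    ∃ i : Fin m → Fin (d + 1), expoOf i = α := by
  have hc : Fintype.card (Fin m) =
      Fintype.card (Σ k : Fin (d + 1), Fin ((Fin.cons (m - deg α) α : Fin (d + 1) → ℕ) k)) := by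
    rw [Fintype.card_sigma, Fin.sum_univ_succ]
    simp only [Fintype.card_fin, Fin.cons_zero, Fin.cons_succ]
    change m = m - deg α + deg α
    omega
  let e := Fintype.equivOfCardEq hc
  refine ⟨fun j => (e j).1, ?_⟩
  funext k
  have h1 : Fintype.card {j // (e j).1 = k.succ} =
      Fintype.card {s : (Σ k : Fin (d + 1),
        Fin ((Fin.cons (m - deg α) α : Fin (d + 1) → ℕ) k)) // s.1 = k.succ} :=
    Fintype.card_congr (e.subtypeEquiv fun _ => Iff.rfl)
  rw [Fintype.card_congr (Equiv.sigmaSubtype k.succ), Fintype.card_fin, Fin.cons_succ,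
    Fintype.card_subtype] at h1
  exact h1

/-! ### The monomial sets `𝔹₀` and `𝔹₁` -/

/-- `x ^ α` comes strictly before `x ^ β` in the graded lexicographic listing
`1, x_1, …, x_d, x_1 ^ 2, x_1 x_2, …`. -/
def Before {d : ℕ} (α β : Expo d) : Prop :=
  deg α < deg β ∨ (deg α = deg β ∧ ∃ k, (∀ l, l < k → α l = β l) ∧ β k < α k)

lemma finite_deg_le (d N : ℕ) : {α : Expo d | deg α ≤ N}.Finite := by
  refine (Set.finite_Icc (0 : Expo d) (fun _ => N)).subset fun α hα => ?_
  refine ⟨fun k => Nat.zero_le _, fun k => ?_⟩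
  exact (Finset.single_le_sum (f := α) (fun _ _ => Nat.zero_le _) (Finset.mem_univ k)).trans hα

lemma finite_firstMonomials (d r : ℕ) :
    {α : Expo d | {β | Before β α}.ncard < r}.Finite := by
  rcases d with _ | d
  · exact Set.toFinite _
  refine (finite_deg_le (d + 1) r).subset fun α hα => ?_
  by_contra hlt
  have hlt' : r < deg α := not_le.mp hlt
  have hfin : {β | Before β α}.Finite := (finite_deg_le (d + 1) (deg α)).subset fun β hβ => by
    rcases hβ with h | h
    · exact h.le
    · exact h.1.le
  have hinj : Set.InjOn (fun k : ℕ => (Pi.single 0 k : Expo (d + 1))) (Set.Iio r) := by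
    intro a _ b _ hab
    exact Pi.single_injective (0 : Fin (d + 1)) hab
  have hsub : (fun k : ℕ => (Pi.single 0 k : Expo (d + 1))) '' (Set.Iio r) ⊆
      {β | Before β α} := by
    rintro _ ⟨k, hk, rfl⟩
    left
    have : deg (Pi.single 0 k : Expo (d + 1)) = k := by simp [deg]
    rw [this]
    exact (Set.mem_Iio.mp hk).trans hlt'
  have h1 := Set.ncard_le_ncard hsub hfin
  rw [hinj.ncard_image] at h1
  have h2 : (Set.Iio r).ncard = r := by
    rw [Set.ncard_eq_toFinset_card']; simp
  rw [h2] at h1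
  exact absurd hα (not_lt.mpr h1)

/-- The first `r` monomials: those with fewer than `r` monomials before them. -/
def B0 (d r : ℕ) : Finset (Expo d) := (finite_firstMonomials d r).toFinset

/-- `(𝔹₀ ∪ x_1 𝔹₀ ∪ ⋯ ∪ x_d 𝔹₀) \ 𝔹₀`. -/
def B1 (d r : ℕ) : Finset (Expo d) :=
  (B0 d r ∪ Finset.univ.biUnion fun k => (B0 d r).image fun ν => ν + Pi.single k 1) \ B0 d r

lemma mem_B0 {d r : ℕ} {α : Expo d} : α ∈ B0 d r ↔ {β | Before β α}.ncard < r := by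
  simp [B0]

lemma shift_mem_B1 {d r : ℕ} {ν : Expo d} (hν : ν ∈ B0 d r) (k : Fin d)
    (h : ν + Pi.single k 1 ∉ B0 d r) : ν + Pi.single k 1 ∈ B1 d r :=
  Finset.mem_sdiff.mpr ⟨Finset.mem_union_right _ (Finset.mem_biUnion.mpr
    ⟨k, Finset.mem_univ k, Finset.mem_image_of_mem _ hν⟩), h⟩

/-! ### The matrices of the algorithm -/

/-- The exponents `γ` with `|γ| ≤ m - |α|` (none if `|α| > m`). -/
def rowSet (m : ℕ) {d : ℕ} (α : Expo d) : Finset (Expo d) :=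
  ((finite_deg_le d m).subset
    (show {γ : Expo d | deg γ + deg α ≤ m} ⊆ {γ | deg γ ≤ m} from
      fun _ h => le_trans (Nat.le_add_right _ _) h)).toFinset

/-- The matrix `A[F, α]` with entries `F_{β + γ}`. -/
def matA {m d : ℕ} (r : ℕ) (F : Tensor m d) (α : Expo d) : Matrix (rowSet m α) (B0 d r) ℂ :=
  fun γ β => entry F (β.1 + γ.1)

/-- The vector `b[F, α]` with entries `F_{α + γ}`. -/
def vecb {m d : ℕ} (F : Tensor m d) (α : Expo d) : rowSet m α → ℂ :=
  fun γ => entry F (α + γ.1)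

/-- Every `A[F, α]`, `α ∈ 𝔹₁`, has full column rank. -/
def FullColumnRank {m d : ℕ} (r : ℕ) (F : Tensor m d) : Prop :=
  ∀ α ∈ B1 d r, LinearIndependent ℂ (matA r F α).col

/-- The linear least squares objective `∑_α ‖A[F, α] G(:, α) - b[F, α]‖ ^ 2`. -/
def lsObjective {m d r : ℕ} (F : Tensor m d) (G : Matrix (B0 d r) (B1 d r) ℂ) : ℝ :=
  ∑ α : B1 d r, ∑ γ, ‖(matA r F α.1 *ᵥ G.col α) γ - vecb F α.1 γ‖ ^ 2

/-- `G` is an optimal solution of the linear least squares problem. -/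
def IsLeastSquares {m d r : ℕ} (F : Tensor m d) (G : Matrix (B0 d r) (B1 d r) ℂ) : Prop :=
  ∀ G' : Matrix (B0 d r) (B1 d r) ℂ, lsObjective F G ≤ lsObjective F G'

open Classical in
/-- The companion matrix `M_{x_k}(G)`. -/
def companion {d r : ℕ} (G : Matrix (B0 d r) (B1 d r) ℂ) (k : Fin d) :
    Matrix (B0 d r) (B0 d r) ℂ :=
  fun μ ν =>
    if h : ν.1 + Pi.single k 1 ∈ B0 d r then
      (if μ.1 = ν.1 + Pi.single k 1 then 1 else 0)
    else G μ ⟨ν.1 + Pi.single k 1, shift_mem_B1 ν.2 k h⟩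

/-- The commutator `[M_{x_k}(G), M_{x_l}(G)]`. -/
def comm {d r : ℕ} (G : Matrix (B0 d r) (B1 d r) ℂ) (k l : Fin d) :
    Matrix (B0 d r) (B0 d r) ℂ :=
  companion G k * companion G l - companion G l * companion G k

/-- `∑_{k < l} ‖[M_{x_k}(G), M_{x_l}(G)]‖_F ^ 2`. -/
def commObjective {d r : ℕ} (G : Matrix (B0 d r) (B1 d r) ℂ) : ℝ :=
  ∑ k : Fin d, ∑ l ∈ Finset.Ioi k, ∑ μ, ∑ ν, ‖comm G k l μ ν‖ ^ 2

/-- `L(ξ) = ∑_k ξ_k M_{x_k}(G)`. -/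
def matL {d r : ℕ} (G : Matrix (B0 d r) (B1 d r) ℂ) (ξ : Fin d → ℂ) :
    Matrix (B0 d r) (B0 d r) ℂ :=
  ∑ k, ξ k • companion G k

/-- The matrix `V_k`, whose columns are the vectorized commutators
`[M_{x_k}(G), M_{x_l}(G)]`, `l = 1, …, d`. -/
def matV {d r : ℕ} (G : Matrix (B0 d r) (B1 d r) ℂ) (k : Fin d) :
    Matrix (B0 d r × B0 d r) (Fin d) ℂ :=
  fun p l => comm G k l p.1 p.2

/-- `V̂ = V_1ᴴ V_1 + ⋯ + V_dᴴ V_d`. -/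
def Vhat {d r : ℕ} (G : Matrix (B0 d r) (B1 d r) ℂ) : Matrix (Fin d) (Fin d) ℂ :=
  ∑ k, (matV G k)ᴴ * matV G k

/-! ### The algorithm -/

/-- A run of the algorithm on the tensor `F` with rank `r`: all the choices that it makes, with
the conditions that they satisfy. -/
structure Run {m d : ℕ} (r : ℕ) (F : Tensor m d) where
  /-- Step 1: `G ^ ls` solves the linear least squares problem and, among its solutions,
  minimizes the commutators of the companion matrices. -/
  G : Matrix (B0 d r) (B1 d r) ℂ
  G_ls : IsLeastSquares F G
  G_comm : ∀ G' : Matrix (B0 d r) (B1 d r) ℂ, IsLeastSquares F G' →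
    commObjective G ≤ commObjective G'
  /-- Step 2: a unit eigenvector of `V̂` for its smallest eigenvalue, and a Schur decomposition
  `Qᴴ L(ξ) Q = T`. -/
  ξ : Fin d → ℂ
  ξ_unit : ∑ k, ‖ξ k‖ ^ 2 = 1
  eig : ℝ
  ξ_eig : Vhat G *ᵥ ξ = (eig : ℂ) • ξ
  eig_least : ∀ t : ℝ, Module.End.HasEigenvalue (Matrix.toLin' (Vhat G)) (t : ℂ) → eig ≤ t
  Q : Matrix (B0 d r) (Fin r) ℂ
  Q_unitary : Qᴴ * Q = 1 ∧ Q * Qᴴ = 1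
  T : Matrix (Fin r) (Fin r) ℂ
  schur : Qᴴ * matL G ξ * Q = T
  T_upper : T.BlockTriangular id
  /-- Step 3: `v_i ^ ls = (q_iᴴ M_{x_1} q_i, …, q_iᴴ M_{x_d} q_i)`, and optimal coefficients. -/
  v : Fin r → Fin d → ℂ
  v_eq : ∀ i k, v i k = (Qᴴ * companion G k * Q) i i
  lam : Fin r → ℂ
  lam_opt : ∀ lam', ‖scaledSum m lam v - F‖ ^ 2 ≤ ‖scaledSum m lam' v - F‖ ^ 2
  /-- Step 4: `u_i ^ ls` is an `m`-th root of `lam_i` times `(1, v_i ^ ls)`. -/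
  root : Fin r → ℂ
  root_pow : ∀ i, root i ^ m = lam i
  uls : Fin r → Fin (d + 1) → ℂ
  uls_eq : ∀ i, uls i = root i • homog (v i)
  /-- Step 5: the iterates of a descent method for `min ‖u_1 ^ {⊗ m} + ⋯ + u_r ^ {⊗ m} - F‖ ^ 2`,
  started at `u ^ ls`. -/
  steps : ℕ
  iter : ℕ → Fin r → Fin (d + 1) → ℂ
  iter_zero : iter 0 = uls
  iter_descent : ∀ s < steps,
    ‖waring m (iter (s + 1)) - F‖ ^ 2 ≤ ‖waring m (iter s) - F‖ ^ 2

/-- The tensor `X ^ gp` of Step 4. -/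
def Run.Xgp {m d r : ℕ} {F : Tensor m d} (R : Run r F) : Tensor m d := waring m R.uls

/-- The tensor `X ^ opt` of Step 5, given by the last iterate. -/
def Run.Xopt {m d r : ℕ} {F : Tensor m d} (R : Run r F) : Tensor m d :=
  waring m (R.iter R.steps)

/-- `L(ξ̂)` has no repeated eigenvalue (with algebraic multiplicities). -/
def Run.NoRepeatedEigenvalue {m d r : ℕ} {F : Tensor m d} (R : Run r F) : Prop :=
  (matL R.G R.ξ).charpoly.roots.Nodup

/-! ### The reference approximation -/

/-- `v_i`, where `u_i = lam_i ^ {1/m} (1, v_i)`. -/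
def dehomog {d r : ℕ} (u : Fin r → Fin (d + 1) → ℂ) : Fin r → Fin d → ℂ :=
  fun i k => u i k.succ / u i 0

/-- `lam_i`, where `u_i = lam_i ^ {1/m} (1, v_i)`. -/
def scaling (m : ℕ) {d r : ℕ} (u : Fin r → Fin (d + 1) → ℂ) : Fin r → ℂ :=
  fun i => u i 0 ^ m

/-- The vectors `[v_i]_{𝔹₀}` are linearly independent. -/
def MonomialsIndependent {d r : ℕ} (v : Fin r → Fin d → ℂ) : Prop :=
  LinearIndependent ℂ fun (i : Fin r) (β : B0 d r) => monomialAt (v i) β.1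

/-- `u` is scaling-optimal for `F`. -/
def ScalingOptimal {m d r : ℕ} (F : Tensor m d) (u : Fin r → Fin (d + 1) → ℂ) : Prop :=
  ∀ lam', ‖scaledSum m (scaling m u) (dehomog u) - F‖ ^ 2 ≤
    ‖scaledSum m lam' (dehomog u) - F‖ ^ 2

end LowRank

end

/-!
The algorithm is stable because everything it computes is governed by the companion matrices, and
these are a Lipschitz function of the tensor near an exact sum of powers.

Let `X = ∑ λ_s (1, v_s)^{⊗ m}` be at distance `ε` from `F`. The vectors `[v_s]_{𝔹₀}` form a basis,
so there is a matrix `G` that expresses the monomials in `𝔹₁` through those in `𝔹₀` at all `v_s`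
(`exists_generates`). It solves the linear systems of `X` exactly. Since the matrices `A[F, α]`
are bounded below, `G` is bounded and the least squares solution differs from it by `O(ε)`
(`entryO_of_generates`, `entryO_sub_of_isLeastSquares`). The companion matrices `N_k` of `G`
commute, as the `[v_s]_{𝔹₀}` are joint left eigenvectors, and the entries of `X` are `f N_{i_1} ⋯
N_{i_m} e`, where `f` lists the entries of `X` on `𝔹₀` and `e` is the unit vector of the monomial
`1` (`Generates.scaledSum_apply_eq`).

The companion matrices `M_k` of the algorithm are `N_k + O(ε)`. Because the eigenvalues of `L = ∑
ξ_k M_k` are separated, an eigenbasis `Z` of `L` can be chosen well-conditioned; it is built from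
the Schur form by Lagrange interpolation polynomials (`triDiagonalizer`). In this basis the `N_k`
commute with a diagonal matrix with separated entries up to `O(ε)`, so they are diagonal up to
`O(ε)`, and their approximate eigenvalues are the numbers `v_i` computed by the algorithm
(`exists_approx_diagonalization`). Inserting this into `f N_{i_1} ⋯ N_{i_m} e` gives coefficients
for which the sum of the powers `(1, v_i)^{⊗ m}` approximates `X` up to `O(ε)`. No matching
between the `v_i` and the `v_s` is needed, and the least squares choice of the coefficients can
only be better. This is the uniform bound.

The constants are obtained by stating all estimates as `O(ε)` along the filter `ε → 0` on the type
of all admissible data. For a fixed tensor the gap between the eigenvalues may depend on the run.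
However, if admissible `X` come arbitrarily close to `F`, then the uniform bound applied to any
one run forces its output to be `F` itself; otherwise the claim is void for small `δ`.
-/

open scoped Matrix

noncomputable section

namespace LowRank

open Asymptotics Filter Polynomial

/-! ### Entrywise order of growth of matrices -/

/-- All entries of the matrices `A x` are `O(g x)` along the filter `l`. -/
def EntryO {ι a b : Type*} (l : Filter ι) (A : ι → Matrix a b ℂ) (g : ι → ℝ) : Prop :=
  ∀ i j, (fun x => A x i j) =O[l] g

section EntryO

variable {ι a b c : Type*} {l : Filter ι} {f g : ι → ℝ}

lemma EntryO.add {A B : ι → Matrix a b ℂ} (hA : EntryO l A g) (hB : EntryO l B g) :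
    EntryO l (fun x => A x + B x) g :=
  fun i j => (hA i j).add (hB i j)

lemma EntryO.sub {A B : ι → Matrix a b ℂ} (hA : EntryO l A g) (hB : EntryO l B g) :
    EntryO l (fun x => A x - B x) g :=
  fun i j => (hA i j).sub (hB i j)

lemma EntryO.trans {A : ι → Matrix a b ℂ} (hA : EntryO l A f) (h : f =O[l] g) : EntryO l A g :=
  fun i j => (hA i j).trans h

lemma EntryO.mul [Fintype b] {A : ι → Matrix a b ℂ} {B : ι → Matrix b c ℂ}
    (hA : EntryO l A f) (hB : EntryO l B g) :
    EntryO l (fun x => A x * B x) (fun x => f x * g x) := fun i j => by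
  simp only [Matrix.mul_apply]
  exact IsBigO.fun_sum fun k _ => (hA i k).mul (hB k j)

lemma EntryO.mul_bounded [Fintype b] {A : ι → Matrix a b ℂ} {B : ι → Matrix b c ℂ}
    (hA : EntryO l A f) (hB : EntryO l B fun _ => 1) :
    EntryO l (fun x => A x * B x) f := by
  simpa using hA.mul hB

lemma EntryO.bounded_mul [Fintype b] {A : ι → Matrix a b ℂ} {B : ι → Matrix b c ℂ}
    (hA : EntryO l A fun _ => 1) (hB : EntryO l B g) :
    EntryO l (fun x => A x * B x) g := by
  simpa using hA.mul hB

lemma EntryO.smul_bounded {s : ι → ℂ} {A : ι → Matrix a b ℂ}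
    (hs : s =O[l] (fun _ => (1 : ℝ))) (hA : EntryO l A g) :
    EntryO l (fun x => s x • A x) g := fun i j => by
  simpa using hs.mul (hA i j)

lemma EntryO.sum {κ : Type*} {s : Finset κ} {A : κ → ι → Matrix a b ℂ}
    (hA : ∀ k ∈ s, EntryO l (A k) g) : EntryO l (fun x => ∑ k ∈ s, A k x) g := fun i j => by
  simp only [Matrix.sum_apply]
  exact IsBigO.fun_sum fun k hk => hA k hk i j

lemma EntryO.conjTranspose {A : ι → Matrix a b ℂ} (hA : EntryO l A g) :
    EntryO l (fun x => (A x)ᴴ) g := fun i j => by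
  refine (IsBigO.of_norm_left ?_)
  simpa using (hA j i).norm_left

lemma entryO_one [DecidableEq a] : EntryO l (fun _ => (1 : Matrix a a ℂ)) (fun _ => (1 : ℝ)) :=
  fun _ _ => isBigO_const_const _ (one_ne_zero (α := ℝ)) _

lemma EntryO.diagonal [DecidableEq a] {v : ι → a → ℂ} (h : ∀ i, (fun x => v x i) =O[l] g) :
    EntryO l (fun x => Matrix.diagonal (v x)) g := fun i j => by
  by_cases hij : i = j
  · subst hij; simpa using h i
  · simpa [Matrix.diagonal_apply_ne _ hij] using isBigO_zero g l

lemma EntryO.updateRow [DecidableEq a] {A : ι → Matrix a b ℂ} {v : b → ℂ} {k : a}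
    (hA : EntryO l A fun _ => 1) : EntryO l (fun x => (A x).updateRow k v) fun _ => 1 :=
  fun i j => by
    by_cases hi : i = k
    · subst hi
      simpa using isBigO_const_const (v j) (one_ne_zero (α := ℝ)) l
    · simpa [Matrix.updateRow_ne hi] using hA i j

lemma EntryO.det [Fintype a] [DecidableEq a] {A : ι → Matrix a a ℂ}
    (hA : EntryO l A fun _ => 1) : (fun x => (A x).det) =O[l] (fun _ => (1 : ℝ)) := by
  simp only [Matrix.det_apply]
  refine IsBigO.fun_sum fun σ _ => ?_
  have h : (fun x => ∏ i, A x (σ i) i) =O[l] (fun _ => ∏ _i : a, (1 : ℝ)) :=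
    IsBigO.finsetProd fun i _ => hA _ _
  refine IsBigO.of_norm_left ?_
  have := h.norm_left
  rcases Int.units_eq_one_or (Equiv.Perm.sign σ) with h1 | h1 <;> simpa [h1] using this

lemma EntryO.adjugate [Fintype a] [DecidableEq a] {A : ι → Matrix a a ℂ}
    (hA : EntryO l A fun _ => 1) : EntryO l (fun x => (A x).adjugate) fun _ => 1 := fun i j => by
  simp only [Matrix.adjugate_apply]
  exact hA.updateRow.det

/-- A matrix with orthonormal columns has entries of modulus at most one. -/
lemma norm_apply_le_one_of_conjTranspose_mul_self [Fintype a] [DecidableEq b]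
    {Q : Matrix a b ℂ} (hQ : Qᴴ * Q = 1) (i : a) (j : b) : ‖Q i j‖ ≤ 1 := by
  have h : ∑ k, ‖Q k j‖ ^ 2 = 1 := by
    have h1 := congrFun (congrFun hQ j) j
    simp only [Matrix.mul_apply, Matrix.conjTranspose_apply, Matrix.one_apply_eq,
      RCLike.star_def, Complex.conj_mul'] at h1
    exact_mod_cast h1
  have h2 : ‖Q i j‖ ^ 2 ≤ 1 :=
    h ▸ Finset.single_le_sum (f := fun k => ‖Q k j‖ ^ 2) (fun _ _ => by positivity)
      (Finset.mem_univ i)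
  nlinarith [norm_nonneg (Q i j)]

end EntryO

/-! ### Diagonalizing triangular matrices with separated eigenvalues -/

section Triangular

variable {r : ℕ} {T : Matrix (Fin r) (Fin r) ℂ}

lemma mul_apply_diag_of_blockTriangular {A B : Matrix (Fin r) (Fin r) ℂ}
    (hA : A.BlockTriangular id) (hB : B.BlockTriangular id) (i : Fin r) :
    (A * B) i i = A i i * B i i := by
  rw [Matrix.mul_apply]
  refine Finset.sum_eq_single i (fun j _ hj => ?_) (by simp)
  rcases lt_or_gt_of_ne hj with h | h
  · rw [hA (show id j < id i from h), zero_mul]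
  · rw [hB (show id i < id j from h), mul_zero]

lemma aeval_blockTriangular (hT : T.BlockTriangular id) (p : ℂ[X]) :
    (aeval T p).BlockTriangular id ∧ ∀ i, aeval T p i i = p.eval (T i i) := by
  induction p using Polynomial.induction_on with
  | C a =>
    rw [aeval_C, Matrix.algebraMap_eq_diagonal]
    exact ⟨Matrix.blockTriangular_diagonal _, fun i => by simp⟩
  | add p q hp hq =>
    rw [map_add]
    exact ⟨hp.1.add hq.1, fun i => by rw [Matrix.add_apply, hp.2, hq.2, eval_add]⟩
  | monomial n a h =>
    rw [pow_succ, ← mul_assoc, map_mul, aeval_X]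
    exact ⟨h.1.mul hT, fun i => by
      rw [mul_apply_diag_of_blockTriangular h.1 hT, h.2, eval_mul_X]⟩

/-- The matrix whose `j`-th column is the `j`-th column of the Lagrange interpolation polynomial
at the `j`-th diagonal entry, applied to `T`. For upper triangular `T` with distinct diagonal
entries its columns are eigenvectors of `T`. -/
def triDiagonalizer (T : Matrix (Fin r) (Fin r) ℂ) : Matrix (Fin r) (Fin r) ℂ :=
  fun i j => aeval T (Lagrange.basis Finset.univ (fun k => T k k) j) i j

lemma triDiagonalizer_blockTriangular (hT : T.BlockTriangular id) :
    (triDiagonalizer T).BlockTriangular id :=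
  fun _ _ hij => (aeval_blockTriangular hT _).1 hij

lemma triDiagonalizer_diag (hT : T.BlockTriangular id) (hinj : Function.Injective fun k => T k k)
    (i : Fin r) : triDiagonalizer T i i = 1 := by
  rw [triDiagonalizer, (aeval_blockTriangular hT _).2]
  have h := Lagrange.eval_basis_self (s := Finset.univ) (v := fun k => T k k) (i := i)
    hinj.injOn (Finset.mem_univ i)
  exact h

lemma triDiagonalizer_det (hT : T.BlockTriangular id) (hinj : Function.Injective fun k => T k k) :
    (triDiagonalizer T).det = 1 := by
  rw [Matrix.det_of_isUpperTriangular (triDiagonalizer_blockTriangular hT)]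
  simp [triDiagonalizer_diag hT hinj]

lemma triDiagonalizer_mul_adjugate (hT : T.BlockTriangular id)
    (hinj : Function.Injective fun k => T k k) :
    triDiagonalizer T * (triDiagonalizer T).adjugate = 1 := by
  rw [Matrix.mul_adjugate, triDiagonalizer_det hT hinj, one_smul]

lemma adjugate_mul_triDiagonalizer (hT : T.BlockTriangular id)
    (hinj : Function.Injective fun k => T k k) :
    (triDiagonalizer T).adjugate * triDiagonalizer T = 1 := by
  rw [Matrix.adjugate_mul, triDiagonalizer_det hT hinj, one_smul]

lemma adjugate_triDiagonalizer_blockTriangular (hT : T.BlockTriangular id)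
    (hinj : Function.Injective fun k => T k k) :
    (triDiagonalizer T).adjugate.BlockTriangular id := by
  have : Invertible (triDiagonalizer T) :=
    ⟨_, adjugate_mul_triDiagonalizer hT hinj, triDiagonalizer_mul_adjugate hT hinj⟩
  rw [← Matrix.inv_eq_left_inv (adjugate_mul_triDiagonalizer hT hinj)]
  exact Matrix.blockTriangular_inv_of_blockTriangular (triDiagonalizer_blockTriangular hT)

lemma mul_triDiagonalizer (hT : T.BlockTriangular id) :
    T * triDiagonalizer T = triDiagonalizer T * Matrix.diagonal fun k => T k k := by
  have hchar : T.charpoly = ∏ k, (X - C (T k k)) := Matrix.charpoly_of_isUpperTriangular _ hT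
  ext i j
  set E := aeval T (Lagrange.basis Finset.univ (fun k => T k k) j) with hE
  -- By Cayley-Hamilton, `T - T j j` annihilates the Lagrange polynomial applied to `T`.
  have h0 : aeval T ((X - C (T j j)) * Lagrange.basis Finset.univ (fun k => T k k) j) = 0 := by
    have h1 : (X - C (T j j)) * Lagrange.basis Finset.univ (fun k => T k k) j =
        (∏ k ∈ Finset.univ.erase j, C (T j j - T k k)⁻¹) * T.charpoly := by
      rw [hchar, Lagrange.basis, ← Finset.mul_prod_erase Finset.univ _ (Finset.mem_univ j)]
      simp only [Lagrange.basisDivisor, Finset.prod_mul_distrib]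
      ring
    rw [h1, map_mul, Matrix.aeval_self_charpoly, mul_zero]
  rw [map_mul, ← hE, map_sub, aeval_X, aeval_C, sub_mul, sub_eq_zero] at h0
  have h2 := congrFun (congrFun h0 i) j
  rw [Matrix.mul_diagonal]
  have h3 : (T * triDiagonalizer T) i j = (T * E) i j := by
    rw [Matrix.mul_apply, Matrix.mul_apply]; rfl
  rw [h3, h2, Matrix.algebraMap_eq_diagonal, Matrix.diagonal_mul]
  simp [triDiagonalizer, hE, mul_comm]

lemma entryO_triDiagonalizer {ι : Type*} {l : Filter ι} {T : ι → Matrix (Fin r) (Fin r) ℂ}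
    (hT : EntryO l T fun _ => 1)
    (hgap : ∀ i j, i ≠ j → (fun x => (T x i i - T x j j)⁻¹) =O[l] (fun _ => (1 : ℝ))) :
    EntryO l (fun x => triDiagonalizer (T x)) fun _ => 1 := by
  intro i j
  have key : ∀ s : Finset (Fin r), j ∉ s → EntryO l
      (fun x => aeval (T x) (∏ k ∈ s, Lagrange.basisDivisor (T x j j) (T x k k)))
      fun _ => 1 := by
    intro s
    induction s using Finset.induction with
    | empty => intro _; simpa using entryO_one
    | insert k s hk ih =>
      intro hj
      rw [Finset.mem_insert, not_or] at hj
      simp only [Finset.prod_insert hk, map_mul]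
      refine EntryO.mul_bounded ?_ (ih hj.2)
      simp only [Lagrange.basisDivisor, map_mul, map_sub, aeval_X, aeval_C]
      simp only [Matrix.algebraMap_eq_diagonal]
      exact (EntryO.diagonal fun _ => hgap j k hj.1).mul_bounded
        (hT.sub (EntryO.diagonal fun _ => hT k k))
  exact key _ (Finset.notMem_erase j _) i j

end Triangular

/-! ### Approximate simultaneous diagonalization -/

/-- Let `M_k = N_k + O(ε)` with commuting `N_k`, and let `∑ ξ_k M_k` have separated eigenvalues.
Then the `N_k` are simultaneously diagonal up to `O(ε)` in a well-conditioned basis `Z` (with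
inverse `Z'`), and the approximate eigenvalues are the diagonal entries of the `M_k` in a Schur
basis of `∑ ξ_k M_k`. The matrix `Z` is an eigenbasis of `∑ ξ_k M_k`: in this basis the `N_k`
commute up to `O(ε)` with a diagonal matrix with separated entries. -/
theorem exists_approx_diagonalization {ι b K : Type*} [Fintype b] [DecidableEq b] [Fintype K]
    {r : ℕ} {l : Filter ι} {ε : ι → ℝ}
    {M N : ι → K → Matrix b b ℂ} {ξ : ι → K → ℂ} {Q : ι → Matrix b (Fin r) ℂ}
    {T : ι → Matrix (Fin r) (Fin r) ℂ}
    (hM : ∀ k, EntryO l (fun x => M x k) fun _ => 1)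
    (hMN : ∀ k, EntryO l (fun x => M x k - N x k) ε)
    (hN : ∀ k, EntryO l (fun x => N x k) fun _ => 1)
    (hcomm : ∀ x k k', N x k * N x k' = N x k' * N x k)
    (hξ : ∀ k, (fun x => ξ x k) =O[l] (fun _ => (1 : ℝ)))
    (hQ : ∀ x, (Q x)ᴴ * Q x = 1 ∧ Q x * (Q x)ᴴ = 1)
    (hT : ∀ x, (Q x)ᴴ * (∑ k, ξ x k • M x k) * Q x = T x)
    (htri : ∀ x, (T x).BlockTriangular id)
    (hinj : ∀ x, Function.Injective fun i => T x i i)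
    (hgap : ∀ i j, i ≠ j → (fun x => (T x i i - T x j j)⁻¹) =O[l] (fun _ => (1 : ℝ))) :
    ∃ (Z : ι → Matrix b (Fin r) ℂ) (Z' : ι → Matrix (Fin r) b ℂ),
      EntryO l Z (fun _ => 1) ∧ EntryO l Z' (fun _ => 1) ∧
      (∀ x, Z' x * Z x = 1) ∧ (∀ x, Z x * Z' x = 1) ∧
      ∀ k, EntryO l
        (fun x => Z' x * N x k * Z x - Matrix.diagonal fun i => ((Q x)ᴴ * M x k * Q x) i i) ε := by
  have hQO : EntryO l Q fun _ => 1 := fun i j =>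
    IsBigO.of_bound 1 (Eventually.of_forall fun x => by
      simpa using norm_apply_le_one_of_conjTranspose_mul_self (hQ x).1 i j)
  have hQO' := hQO.conjTranspose
  have hTO : EntryO l T fun _ => 1 := by
    have h := (hQO'.mul_bounded (EntryO.sum (s := Finset.univ)
      fun k _ => (hM k).smul_bounded (hξ k))).mul_bounded hQO
    simpa only [hT] using h
  set P : ι → Matrix (Fin r) (Fin r) ℂ := fun x => triDiagonalizer (T x) with hP
  set P' : ι → Matrix (Fin r) (Fin r) ℂ := fun x => (P x).adjugate with hP'
  have hPO : EntryO l P fun _ => 1 := entryO_triDiagonalizer hTO hgap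
  have hPO' : EntryO l P' fun _ => 1 := hPO.adjugate
  have hPP' : ∀ x, P x * P' x = 1 := fun x => triDiagonalizer_mul_adjugate (htri x) (hinj x)
  have hP'P : ∀ x, P' x * P x = 1 := fun x => adjugate_mul_triDiagonalizer (htri x) (hinj x)
  have hZO := hQO.mul_bounded hPO
  have hZO' := hPO'.mul_bounded hQO'
  have hZ'Z : ∀ x, (P' x * (Q x)ᴴ) * (Q x * P x) = 1 := fun x => by
    rw [Matrix.mul_assoc, ← Matrix.mul_assoc _ (Q x), (hQ x).1, Matrix.one_mul, hP'P]
  have hZZ' : ∀ x, (Q x * P x) * (P' x * (Q x)ᴴ) = 1 := fun x => by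
    rw [Matrix.mul_assoc, ← Matrix.mul_assoc (P x), hPP', Matrix.one_mul, (hQ x).2]
  refine ⟨fun x => Q x * P x, fun x => P' x * (Q x)ᴴ, hZO, hZO', hZ'Z, hZZ', fun k => ?_⟩
  set S : ι → Matrix (Fin r) (Fin r) ℂ := fun x => P' x * (Q x)ᴴ * N x k * (Q x * P x) with hS
  have hSO : EntryO l S fun _ => 1 := (hZO'.mul_bounded (hN k)).mul_bounded hZO
  -- `D` is the diagonal form of the perturbed combination, and `R` is the perturbation.
  set D : ι → Matrix (Fin r) (Fin r) ℂ := fun x => Matrix.diagonal fun i => T x i i with hD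
  set R : ι → Matrix (Fin r) (Fin r) ℂ := fun x =>
    P' x * (Q x)ᴴ * (∑ k, ξ x k • (M x k - N x k)) * (Q x * P x) with hR
  have hRO : EntryO l R ε := (hZO'.bounded_mul (EntryO.sum (s := Finset.univ)
    fun k _ => (hMN k).smul_bounded (hξ k))).mul_bounded hZO
  have hDx : ∀ x, P' x * (Q x)ᴴ * (∑ k, ξ x k • M x k) * (Q x * P x) = D x := fun x => by
    calc _ = P' x * ((Q x)ᴴ * (∑ k, ξ x k • M x k) * Q x) * P x := by
            simp only [Matrix.mul_assoc]
      _ = P' x * (P x * D x) := by rw [hT, Matrix.mul_assoc, mul_triDiagonalizer (htri x)]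
      _ = D x := by rw [← Matrix.mul_assoc, hP'P, Matrix.one_mul]
  -- The unperturbed combination commutes with `N k`.
  have hcomm' : ∀ x, S x * (D x - R x) = (D x - R x) * S x := fun x => by
    have h1 : D x - R x = P' x * (Q x)ᴴ * (∑ k, ξ x k • N x k) * (Q x * P x) := by
      rw [← hDx, hR, ← Matrix.sub_mul, ← Matrix.mul_sub, ← Finset.sum_sub_distrib]
      simp only [smul_sub, sub_sub_cancel]
    have h2 : N x k * (∑ k, ξ x k • N x k) = (∑ k, ξ x k • N x k) * N x k := by
      simp only [Matrix.mul_sum, Matrix.sum_mul, Matrix.mul_smul, Matrix.smul_mul, hcomm x k]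
    have h3 : ∀ A B : Matrix b b ℂ, P' x * (Q x)ᴴ * A * (Q x * P x) *
        (P' x * (Q x)ᴴ * B * (Q x * P x)) = P' x * (Q x)ᴴ * (A * B) * (Q x * P x) := fun A B => by
      calc _ = P' x * (Q x)ᴴ * A * ((Q x * P x) * (P' x * (Q x)ᴴ)) * B * (Q x * P x) := by
              simp only [Matrix.mul_assoc]
        _ = _ := by rw [hZZ', Matrix.mul_one]; simp only [Matrix.mul_assoc]
    rw [h1, hS, h3, h3, h2]
  have hbr : EntryO l (fun x => S x * D x - D x * S x) ε := by
    have h := (hSO.bounded_mul hRO).sub (hRO.mul_bounded hSO)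
    refine fun i j => (h i j).congr_left fun x => ?_
    have h1 := hcomm' x
    rw [Matrix.mul_sub, Matrix.sub_mul, sub_eq_sub_iff_sub_eq_sub] at h1
    exact (congrFun (congrFun h1 i) j).symm
  -- Since the eigenvalues are separated, `S` is almost diagonal.
  have hoff : ∀ i j, i ≠ j → (fun x => S x i j) =O[l] ε := fun i j hij => by
    have h := (hgap j i hij.symm).mul (hbr i j)
    simp only [one_mul] at h
    refine h.congr_left fun x => ?_
    have hne : T x j j - T x i i ≠ 0 := sub_ne_zero.mpr fun h => hij.symm (hinj x h)
    simp only [hD, Matrix.sub_apply, Matrix.mul_diagonal, Matrix.diagonal_mul]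
    field_simp
  have hoffM : EntryO l (fun x => S x - Matrix.diagonal fun i => S x i i) ε := fun i j => by
    by_cases hij : i = j
    · subst hij; simpa using isBigO_zero ε l
    · simpa [Matrix.diagonal_apply_ne _ hij] using hoff i j hij
  have hback : ∀ x, P x * S x * P' x = (Q x)ᴴ * N x k * Q x := fun x => by
    calc _ = (P x * P' x) * ((Q x)ᴴ * N x k * Q x) * (P x * P' x) := by
            simp only [hS, Matrix.mul_assoc]
      _ = _ := by rw [hPP', Matrix.one_mul, Matrix.mul_one]
  -- Conjugating a diagonal matrix by a unitriangular one does not change the diagonal.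
  have hdiag : ∀ i, (fun x => ((Q x)ᴴ * M x k * Q x) i i - S x i i) =O[l] ε := fun i => by
    have h1 := ((hQO'.bounded_mul (hMN k)).mul_bounded hQO) i i
    have h2 := ((hPO.bounded_mul hoffM).mul_bounded hPO') i i
    refine (h1.add h2).congr_left fun x => ?_
    have hPt := triDiagonalizer_blockTriangular (htri x)
    have hPt' : (P' x).BlockTriangular id :=
      adjugate_triDiagonalizer_blockTriangular (htri x) (hinj x)
    have hdt : (Matrix.diagonal fun i => S x i i).BlockTriangular id :=
      Matrix.blockTriangular_diagonal _
    have h4 : (P x * (Matrix.diagonal fun i => S x i i) * P' x) i i = S x i i := by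
      have h5 : P x i i * P' x i i = 1 := by
        rw [← mul_apply_diag_of_blockTriangular hPt hPt', hPP', Matrix.one_apply_eq]
      rw [mul_apply_diag_of_blockTriangular (hPt.mul hdt) hPt',
        mul_apply_diag_of_blockTriangular hPt hdt, Matrix.diagonal_apply_eq,
        mul_right_comm, h5, one_mul]
    beta_reduce
    rw [Matrix.mul_sub, Matrix.sub_mul, Matrix.mul_sub, Matrix.sub_mul, hback,
      Matrix.sub_apply, Matrix.sub_apply, h4]
    ring
  have hdiagM : EntryO l (fun x => Matrix.diagonal fun i =>
      ((Q x)ᴴ * M x k * Q x) i i - S x i i) ε := EntryO.diagonal hdiag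
  refine fun i j => ((hoffM.sub hdiagM) i j).congr_left fun x => ?_
  by_cases hij : i = j
  · subst hij; simp [hS]
  · simp [Matrix.diagonal_apply_ne _ hij, hS]

/-- A product of matrices that are diagonal up to `O(ε)` is diagonal up to `O(ε)`. -/
lemma entryO_list_prod_sub_diagonal {ι K : Type*} {r : ℕ} {l : Filter ι} {ε : ι → ℝ}
    {S : ι → K → Matrix (Fin r) (Fin r) ℂ} {w : ι → K → Fin r → ℂ}
    (hS : ∀ k, EntryO l (fun x => S x k) fun _ => 1)
    (hw : ∀ k i, (fun x => w x k i) =O[l] (fun _ => (1 : ℝ)))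
    (h : ∀ k, EntryO l (fun x => S x k - Matrix.diagonal (w x k)) ε) (L : List K) :
    EntryO l (fun x => (L.map (S x)).prod -
      Matrix.diagonal fun i => (L.map fun k => w x k i).prod) ε := by
  suffices hs : (∀ i, (fun x => (L.map fun k => w x k i).prod) =O[l] (fun _ => (1 : ℝ))) ∧
      EntryO l (fun x => (L.map (S x)).prod -
        Matrix.diagonal fun i => (L.map fun k => w x k i).prod) ε from hs.2
  induction L with
  | nil =>
    refine ⟨fun i => by simpa using isBigO_const_const (1 : ℂ) (one_ne_zero (α := ℝ)) l,
      fun i j => ?_⟩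
    simpa using isBigO_zero ε l
  | cons k L ih =>
    refine ⟨fun i => by simpa using (hw k i).mul (ih.1 i), ?_⟩
    have h1 := ((hS k).bounded_mul ih.2).add ((h k).mul_bounded (EntryO.diagonal ih.1))
    refine fun i j => (h1 i j).congr_left fun x => congrFun (congrFun ?_ i) j
    simp only [List.map_cons, List.prod_cons]
    rw [← Matrix.diagonal_mul_diagonal, Matrix.mul_sub, Matrix.sub_mul]
    abel

/-! ### Degrees of the monomials in `𝔹₀` and `𝔹₁` -/

section Monomials

variable {m d r : ℕ}

lemma deg_add (α β : Expo d) : deg (α + β) = deg α + deg β := by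
  simp [deg, Finset.sum_add_distrib]

lemma deg_single (k : Fin d) : deg (Pi.single k 1 : Expo d) = 1 := by
  simp [deg]

lemma zero_mem_B0 (hr : 0 < r) : (0 : Expo d) ∈ B0 d r := by
  have h : {β : Expo d | Before β 0} = ∅ := by
    ext β
    simp only [Set.mem_ofPred_eq, Set.mem_empty_iff_false, iff_false]
    rintro (h | ⟨h, k, -, hk⟩)
    · simp [deg] at h
    · have h1 : β k ≤ deg β := Finset.single_le_sum (f := β) (fun _ _ => Nat.zero_le _)
        (Finset.mem_univ k)
      have h2 : deg (0 : Expo d) = 0 := by simp [deg]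
      simp only [Pi.zero_apply] at hk
      omega
  rw [mem_B0, h]
  simpa using hr

/-- The listing of monomials is graded. -/
lemma deg_le_deg_of_mem_B0_of_notMem {α β : Expo d} (hβ : β ∈ B0 d r) (hα : α ∉ B0 d r) :
    deg β ≤ deg α := by
  by_contra! hlt
  rw [mem_B0] at hβ hα
  have hfin : {γ | Before γ β}.Finite := (finite_deg_le d (deg β)).subset fun γ hγ => by
    rcases hγ with h | h
    · exact h.le
    · exact h.1.le
  refine hα ((Set.ncard_le_ncard (fun γ hγ => ?_) hfin).trans_lt hβ)
  rcases hγ with h | h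
  · exact Or.inl (h.trans hlt)
  · exact Or.inl (h.1.trans_lt hlt)

lemma notMem_B0_of_mem_B1 {α : Expo d} (hα : α ∈ B1 d r) : α ∉ B0 d r :=
  (Finset.mem_sdiff.mp hα).2

lemma B1_nonempty (hd : 0 < d) (hr : 0 < r) : (B1 d r).Nonempty := by
  obtain ⟨β, hβ, hmax⟩ := Finset.exists_max_image (B0 d r) deg ⟨0, zero_mem_B0 hr⟩
  refine ⟨_, shift_mem_B1 hβ ⟨0, hd⟩ fun h => ?_⟩
  have := hmax _ h
  rw [deg_add, deg_single] at this
  omega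

lemma deg_le_of_mem_B1 {F : Tensor m d} (hF : FullColumnRank r F) (hr : 0 < r) {α : Expo d}
    (hα : α ∈ B1 d r) : deg α ≤ m := by
  by_contra! hlt
  refine (hF α hα).ne_zero ⟨0, zero_mem_B0 hr⟩ (funext fun γ => ?_)
  have hγ : deg γ.1 + deg α ≤ m := by simpa [rowSet] using γ.2
  omega

lemma deg_le_of_mem_B0 {F : Tensor m d} (hF : FullColumnRank r F) (hd : 0 < d) (hr : 0 < r)
    {β : Expo d} (hβ : β ∈ B0 d r) : deg β ≤ m := by
  obtain ⟨α, hα⟩ := B1_nonempty hd hr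
  exact (deg_le_deg_of_mem_B0_of_notMem hβ (notMem_B0_of_mem_B1 hα)).trans
    (deg_le_of_mem_B1 hF hr hα)

lemma monomialAt_add (v : Fin d → ℂ) (α β : Expo d) :
    monomialAt v (α + β) = monomialAt v α * monomialAt v β := by
  simp [monomialAt, pow_add, Finset.prod_mul_distrib]

lemma monomialAt_zero (v : Fin d → ℂ) : monomialAt v 0 = 1 := by simp [monomialAt]

lemma monomialAt_single (v : Fin d → ℂ) (k : Fin d) :
    monomialAt v (Pi.single k 1) = v k := by
  rw [monomialAt, Finset.prod_eq_single k]
  · simp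
  · intro j _ hj; simp [hj]
  · simp

lemma prod_homog (v : Fin d → ℂ) (i : Fin m → Fin (d + 1)) :
    ∏ j, homog v (i j) = monomialAt v (expoOf i) := by
  rw [← Finset.prod_fiberwise' Finset.univ i (homog v), Fin.prod_univ_succ]
  simp [homog, monomialAt, expoOf, Finset.prod_const]

/-! ### Entries of tensors -/

lemma scaledSum_apply (lam : Fin r → ℂ) (v : Fin r → Fin d → ℂ) (i : Fin m → Fin (d + 1)) :
    scaledSum m lam v i = ∑ s, lam s * ∏ j, homog (v s) (i j) := by
  simp [scaledSum, tpow]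

lemma norm_entry_le (F : Tensor m d) (α : Expo d) : ‖entry F α‖ ≤ ‖F‖ := by
  rw [entry]
  split_ifs
  · exact PiLp.norm_apply_le F _
  · simp

lemma entry_sub (F X : Tensor m d) (α : Expo d) :
    entry (F - X) α = entry F α - entry X α := by
  simp only [entry]
  split_ifs <;> simp

lemma entry_scaledSum (lam : Fin r → ℂ) (v : Fin r → Fin d → ℂ) {α : Expo d} (hα : deg α ≤ m) :
    entry (scaledSum m lam v) α = ∑ s, lam s * monomialAt (v s) α := by
  have h := exists_expoOf hα
  rw [entry, dif_pos h, scaledSum_apply]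
  simp only [prod_homog, h.choose_spec]

lemma tpow_smul (c : ℂ) (u : Fin (d + 1) → ℂ) : tpow m (c • u) = c ^ m • tpow m u := by
  ext i
  simp [tpow, Finset.prod_mul_distrib]

lemma waring_eq_scaledSum (u : Fin r → Fin (d + 1) → ℂ) (hu : ∀ i, u i 0 ≠ 0) :
    waring m u = scaledSum m (scaling m u) (dehomog u) := by
  rw [waring, scaledSum]
  refine Finset.sum_congr rfl fun i _ => ?_
  rw [scaling, ← tpow_smul]
  congr 1
  funext k
  refine Fin.cases ?_ (fun k => ?_) k
  · simp [homog]
  · simp [homog, dehomog, mul_div_cancel₀ _ (hu i)]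

lemma Run.Xgp_eq {F : Tensor m d} (R : Run r F) : R.Xgp = scaledSum m R.lam R.v := by
  rw [Run.Xgp, waring, scaledSum]
  refine Finset.sum_congr rfl fun i _ => ?_
  rw [R.uls_eq, tpow_smul, R.root_pow]

lemma Run.norm_sub_Xgp_le {F : Tensor m d} (R : Run r F) (lam : Fin r → ℂ) :
    ‖F - R.Xgp‖ ≤ ‖F - scaledSum m lam R.v‖ := by
  rw [R.Xgp_eq, norm_sub_rev F, norm_sub_rev F]
  exact le_of_sq_le_sq (R.lam_opt lam) (norm_nonneg _)

lemma Run.norm_sub_Xopt_le {F : Tensor m d} (R : Run r F) : ‖F - R.Xopt‖ ≤ ‖F - R.Xgp‖ := by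
  have h : ∀ s ≤ R.steps, ‖waring m (R.iter s) - F‖ ^ 2 ≤ ‖waring m R.uls - F‖ ^ 2 := by
    intro s
    induction s with
    | zero => intro _; rw [R.iter_zero]
    | succ s ih => intro hs; exact (R.iter_descent s hs).trans (ih (by omega))
  rw [norm_sub_rev F, norm_sub_rev F]
  exact le_of_sq_le_sq (h _ le_rfl) (norm_nonneg _)

lemma Run.pos_of_run {F : Tensor m d} (R : Run r F) : 0 < d := by
  rcases Nat.eq_zero_or_pos d with rfl | h
  · simpa using R.ξ_unit
  · exact h

lemma Run.card_B0 {F : Tensor m d} (R : Run r F) : Fintype.card (B0 d r) = r := by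
  have h1 := congrArg Matrix.trace R.Q_unitary.1
  rw [Matrix.trace_mul_comm, R.Q_unitary.2, Matrix.trace_one, Matrix.trace_one,
    Fintype.card_fin] at h1
  exact_mod_cast h1

/-! ### The generating matrix of a point configuration -/

/-- The Vandermonde matrix of the values of the monomials in `𝔹₀` at the points `v_s`. -/
def vandermondeB0 (v : Fin r → Fin d → ℂ) : Matrix (Fin r) (B0 d r) ℂ :=
  fun s β => monomialAt (v s) β.1

lemma exists_inverse_vandermondeB0 {v : Fin r → Fin d → ℂ} (hv : MonomialsIndependent v)
    (hcard : Fintype.card (B0 d r) = r) :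
    ∃ W' : Matrix (B0 d r) (Fin r) ℂ, W' * vandermondeB0 v = 1 ∧ vandermondeB0 v * W' = 1 := by
  obtain ⟨e⟩ : Nonempty (Fin r ≃ B0 d r) := ⟨Fintype.equivOfCardEq (by simp [hcard])⟩
  have hind : LinearIndependent ℂ ((vandermondeB0 v).submatrix id e).row :=
    (hv.map' (LinearEquiv.funCongrLeft ℂ ℂ e).toLinearMap (LinearEquiv.ker _) :)
  have hu := Matrix.linearIndependent_rows_iff_isUnit.mp hind
  obtain ⟨U, hU⟩ := hu.exists_right_inv
  have h1 : vandermondeB0 v * U.submatrix e.symm id = 1 := by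
    rw [← hU]
    ext i j
    simp only [Matrix.mul_apply, Matrix.submatrix_apply, id_eq]
    rw [← e.sum_comp]
    simp
  exact ⟨_, (Matrix.mul_eq_one_comm_of_card_eq _ _ _ (by simp [hcard])).mp h1, h1⟩

/-- `G` expresses the monomials in `𝔹₁` through those in `𝔹₀` at all points `v_s`. -/
def Generates (G : Matrix (B0 d r) (B1 d r) ℂ) (v : Fin r → Fin d → ℂ) : Prop :=
  ∀ s (α : B1 d r), ∑ β : B0 d r, monomialAt (v s) β.1 * G β α = monomialAt (v s) α.1

lemma exists_generates {v : Fin r → Fin d → ℂ} (hv : MonomialsIndependent v)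
    (hcard : Fintype.card (B0 d r) = r) :
    ∃ G : Matrix (B0 d r) (B1 d r) ℂ, Generates G v := by
  obtain ⟨W', -, hW⟩ := exists_inverse_vandermondeB0 hv hcard
  refine ⟨W' * Matrix.of fun s α => monomialAt (v s) α.1, fun s α => ?_⟩
  have h : vandermondeB0 v * (W' * Matrix.of fun s (α : B1 d r) => monomialAt (v s) α.1) =
      Matrix.of fun s α => monomialAt (v s) α.1 := by
    rw [← Matrix.mul_assoc, hW, Matrix.one_mul]
  exact congrFun (congrFun h s) α

variable {G : Matrix (B0 d r) (B1 d r) ℂ} {v : Fin r → Fin d → ℂ}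

/-- The vectors `[v_s]_{𝔹₀}` are left eigenvectors of the companion matrices. -/
lemma Generates.vandermondeB0_mul_companion (h : Generates G v) (k : Fin d) :
    vandermondeB0 v * companion G k = Matrix.diagonal (fun s => v s k) * vandermondeB0 v := by
  ext s ν
  have hshift : v s k * monomialAt (v s) ν.1 = monomialAt (v s) (ν.1 + Pi.single k 1) := by
    rw [monomialAt_add, monomialAt_single, mul_comm]
  rw [Matrix.diagonal_mul, Matrix.mul_apply]
  simp only [vandermondeB0]
  rw [hshift]
  by_cases hν : ν.1 + Pi.single k 1 ∈ B0 d r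
  · rw [Finset.sum_eq_single (⟨_, hν⟩ : B0 d r)]
    · simp [companion, hν]
    · intro μ _ hμ
      have : μ.1 ≠ ν.1 + Pi.single k 1 := fun h => hμ (Subtype.ext h)
      simp [companion, hν, this]
    · simp
  · simpa [companion, hν] using h s ⟨_, shift_mem_B1 ν.2 k hν⟩

lemma Generates.companion_comm (h : Generates G v) (hv : MonomialsIndependent v)
    (hcard : Fintype.card (B0 d r) = r) (k l : Fin d) :
    companion G k * companion G l = companion G l * companion G k := by
  obtain ⟨W', hW, -⟩ := exists_inverse_vandermondeB0 hv hcard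
  have h1 : ∀ k l, vandermondeB0 v * (companion G k * companion G l) =
      Matrix.diagonal (fun s => v s k * v s l) * vandermondeB0 v := fun k l => by
    rw [← Matrix.mul_assoc, h.vandermondeB0_mul_companion, Matrix.mul_assoc,
      h.vandermondeB0_mul_companion, ← Matrix.mul_assoc, Matrix.diagonal_mul_diagonal]
  have h2 : vandermondeB0 v * (companion G k * companion G l) =
      vandermondeB0 v * (companion G l * companion G k) := by
    rw [h1, h1]
    simp only [mul_comm]
  have h3 := congrArg (W' * ·) h2
  simpa only [← Matrix.mul_assoc, hW, Matrix.one_mul] using h3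

/-- The companion matrices, with the identity as the matrix of multiplication by `x_0 = 1`. -/
def homogCompanion (G : Matrix (B0 d r) (B1 d r) ℂ) : Fin (d + 1) → Matrix (B0 d r) (B0 d r) ℂ :=
  Fin.cons 1 (companion G)

lemma Generates.vandermondeB0_mul_list_prod (h : Generates G v) (L : List (Fin (d + 1))) :
    vandermondeB0 v * (L.map (homogCompanion G)).prod =
      Matrix.diagonal (fun s => (L.map (homog (v s))).prod) * vandermondeB0 v := by
  induction L with
  | nil => simp
  | cons k L ih =>
    have hk : vandermondeB0 v * homogCompanion G k =
        Matrix.diagonal (fun s => homog (v s) k) * vandermondeB0 v := by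
      refine Fin.cases ?_ (fun k => ?_) k
      · simp [homogCompanion, homog]
      · simpa [homogCompanion, homog] using h.vandermondeB0_mul_companion k
    simp only [List.map_cons, List.prod_cons]
    rw [← Matrix.mul_assoc, hk, Matrix.mul_assoc, ih, ← Matrix.mul_assoc,
      Matrix.diagonal_mul_diagonal]

/-- The entries of `∑ λ_s (1, v_s)^{⊗ m}` are read off from products of companion matrices. -/
lemma Generates.scaledSum_apply_eq (h : Generates G v) (hr : 0 < r) (lam : Fin r → ℂ)
    (i : Fin m → Fin (d + 1)) :
    scaledSum m lam v i = (Matrix.replicateRow Unit (lam ᵥ* vandermondeB0 v) *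
      ((List.ofFn i).map (homogCompanion G)).prod) () ⟨0, zero_mem_B0 hr⟩ := by
  rw [← Matrix.replicateRow_vecMul, Matrix.replicateRow_apply, Matrix.vecMul_vecMul,
    h.vandermondeB0_mul_list_prod, scaledSum_apply]
  simp [Matrix.vecMul, dotProduct, Matrix.diagonal_mul, vandermondeB0, monomialAt_zero,
    List.map_ofFn, List.prod_ofFn]

/-- The generating matrix solves the linear systems of the exact tensor. -/
lemma Generates.matA_mulVec_col (h : Generates G v) (lam : Fin r → ℂ) (α : B1 d r)
    (γ : rowSet m α.1) :
    (matA r (scaledSum m lam v) α.1 *ᵥ G.col α) γ = vecb (scaledSum m lam v) α.1 γ := by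
  have hγ : deg γ.1 + deg α.1 ≤ m := by simpa [rowSet] using γ.2
  have hβ : ∀ β : B0 d r, deg (β.1 + γ.1) ≤ m := fun β => by
    have := deg_le_deg_of_mem_B0_of_notMem β.2 (notMem_B0_of_mem_B1 α.2)
    rw [deg_add]; omega
  have hα : deg (α.1 + γ.1) ≤ m := by rw [deg_add]; omega
  rw [Matrix.mulVec, dotProduct, vecb, entry_scaledSum _ _ hα]
  simp only [matA, entry_scaledSum _ _ (hβ _), Matrix.col_apply, Finset.sum_mul]
  rw [Finset.sum_comm]
  refine Finset.sum_congr rfl fun s _ => ?_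
  rw [monomialAt_add, ← h s α, Finset.sum_mul, Finset.mul_sum]
  refine Finset.sum_congr rfl fun β _ => ?_
  rw [monomialAt_add]
  ring

end Monomials

/-! ### Perturbation of the least squares solution -/

section Perturbation

lemma norm_apply_le_mul_sum_of_sq_le {a b : Type*} [Fintype a] [Fintype b] {κ : ℝ} (hκ : 0 ≤ κ)
    {g : b → ℂ} {h : a → ℂ} (hgh : ∑ β, ‖g β‖ ^ 2 ≤ κ ^ 2 * ∑ γ, ‖h γ‖ ^ 2) (β : b) :
    ‖g β‖ ≤ κ * ∑ γ, ‖h γ‖ := by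
  refine le_of_sq_le_sq ?_ (mul_nonneg hκ (Finset.sum_nonneg fun _ _ => norm_nonneg _))
  rw [mul_pow]
  calc ‖g β‖ ^ 2 ≤ ∑ β, ‖g β‖ ^ 2 :=
        Finset.single_le_sum (f := fun β => ‖g β‖ ^ 2) (fun _ _ => by positivity)
          (Finset.mem_univ β)
    _ ≤ κ ^ 2 * ∑ γ, ‖h γ‖ ^ 2 := hgh
    _ ≤ κ ^ 2 * (∑ γ, ‖h γ‖) ^ 2 := by
        gcongr
        exact Finset.sum_sq_le_sq_sum_of_nonneg fun _ _ => norm_nonneg _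

/-- A self-referential bound `s ≤ K (c + ε s)` with `ε → 0` bounds `s` by `c`. -/
lemma isBigO_of_le_mul_add {ι : Type*} {l : Filter ι} {s c ε : ι → ℝ} {K : ℝ}
    (hε : Tendsto ε l (nhds 0)) (hs : ∀ x, 0 ≤ s x) (hK : 0 ≤ K)
    (h : ∀ x, s x ≤ K * (c x + ε x * s x)) : s =O[l] c := by
  have hε' : ∀ᶠ x in l, K * ε x < 1 / 2 := by
    have h1 : Tendsto (fun x => K * ε x) l (nhds 0) := by simpa using hε.const_mul K
    exact h1.eventually_lt_const (by norm_num)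
  refine IsBigO.of_bound (2 * K) (hε'.mono fun x hx => ?_)
  have h1 := mul_le_mul_of_nonneg_right hx.le (hs x)
  have h2 := mul_le_mul_of_nonneg_left (le_abs_self (c x)) hK
  rw [Real.norm_eq_abs, Real.norm_eq_abs, abs_of_nonneg (hs x)]
  nlinarith [h x]

variable {ι : Type*} {l : Filter ι} {m d r : ℕ} {κ : ℝ} {F : ι → Tensor m d}
  {lam : ι → Fin r → ℂ} {v : ι → Fin r → Fin d → ℂ} {ε : ι → ℝ}
  {G Gls : ι → Matrix (B0 d r) (B1 d r) ℂ}

lemma isBigO_entry {X : ι → Tensor m d} {g : ι → ℝ} (h : X =O[l] g) (α : Expo d) :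
    (fun x => entry (X x) α) =O[l] g :=
  (IsBigO.of_norm_le fun x => norm_entry_le (X x) α).trans h.norm_left

/-- The lower bounds on the matrices `A[F, α]` transfer the order of growth of `A[F, α] G(:, α)`
to `G`. -/
lemma entryO_of_isBigO_mulVec (hκ0 : 0 ≤ κ)
    (hκ : ∀ x, ∀ α ∈ B1 d r, ∀ g : B0 d r → ℂ,
      ∑ β, ‖g β‖ ^ 2 ≤ κ ^ 2 * ∑ γ, ‖(matA r (F x) α *ᵥ g) γ‖ ^ 2)
    (h : ∀ (α : B1 d r) γ, (fun x => (matA r (F x) α.1 *ᵥ (G x).col α) γ) =O[l] ε) :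
    EntryO l G ε := fun β α => by
  have h1 : (fun x => κ * ∑ γ, ‖(matA r (F x) α.1 *ᵥ (G x).col α) γ‖) =O[l] ε :=
    (IsBigO.fun_sum fun γ _ => (h α γ).norm_left).const_mul_left κ
  exact (IsBigO.of_norm_le fun x =>
    norm_apply_le_mul_sum_of_sq_le hκ0 (hκ x α.1 α.2 ((G x).col α)) β).trans h1

/-- The generating matrices of nearby exact tensors are bounded. -/
lemma entryO_of_generates (hκ0 : 0 ≤ κ)
    (hκ : ∀ x, ∀ α ∈ B1 d r, ∀ g : B0 d r → ℂ,
      ∑ β, ‖g β‖ ^ 2 ≤ κ ^ 2 * ∑ γ, ‖(matA r (F x) α *ᵥ g) γ‖ ^ 2)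
    (hF : F =O[l] (fun _ => (1 : ℝ))) (hG : ∀ x, Generates (G x) (v x))
    (hε : ∀ x, ‖F x - scaledSum m (lam x) (v x)‖ ≤ ε x) (hε0 : Tendsto ε l (nhds 0)) :
    EntryO l G fun _ => 1 := fun β α => by
  set X : ι → Tensor m d := fun x => scaledSum m (lam x) (v x) with hX
  have hXO : X =O[l] (fun _ => (1 : ℝ)) := by
    have h1 : (fun x => F x - X x) =O[l] (fun _ => (1 : ℝ)) :=
      (IsBigO.of_norm_le hε).trans (hε0.isBigO_one ℝ)
    simpa using hF.sub h1
  set s : ι → ℝ := fun x => ∑ β, ‖(G x).col α β‖ with hs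
  have hs0 : ∀ x, 0 ≤ s x := fun x => Finset.sum_nonneg fun _ _ => norm_nonneg _
  have hrow : ∀ x γ, ‖(matA r (F x) α.1 *ᵥ (G x).col α) γ‖ ≤ ‖X x‖ + ε x * s x := fun x γ => by
    have h1 : (matA r (F x) α.1 *ᵥ (G x).col α) γ = vecb (X x) α.1 γ +
        ∑ β : B0 d r, entry (F x - X x) (β.1 + γ.1) * (G x).col α β := by
      rw [← (hG x).matA_mulVec_col (lam x) α γ]
      simp only [Matrix.mulVec, dotProduct, matA, ← Finset.sum_add_distrib, ← add_mul,
        entry_sub, hX, add_sub_cancel]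
    rw [h1]
    refine (norm_add_le _ _).trans (add_le_add (norm_entry_le _ _) ?_)
    rw [hs, Finset.mul_sum]
    refine (norm_sum_le _ _).trans (Finset.sum_le_sum fun β _ => ?_)
    rw [norm_mul]
    gcongr
    exact (norm_entry_le _ _).trans (hε x)
  have hsO : s =O[l] (fun x => ‖X x‖) := by
    refine isBigO_of_le_mul_add (K := Fintype.card (B0 d r) * (κ * Fintype.card (rowSet m α.1)))
      hε0 hs0 (by positivity) fun x => ?_
    have h1 : ∀ β ∈ Finset.univ, ‖(G x).col α β‖ ≤
        κ * (Fintype.card (rowSet m α.1) * (‖X x‖ + ε x * s x)) := fun β _ => by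
      refine (norm_apply_le_mul_sum_of_sq_le hκ0 (hκ x α.1 α.2 _) β).trans ?_
      gcongr
      simpa only [Finset.card_univ, nsmul_eq_mul] using
        Finset.sum_le_card_nsmul Finset.univ _ _ fun γ _ => hrow x γ
    have h2 := Finset.sum_le_card_nsmul Finset.univ _ _ h1
    simp only [Finset.card_univ, nsmul_eq_mul] at h2
    refine h2.trans_eq (by ring)
  refine (IsBigO.of_norm_le fun x => ?_).trans (hsO.trans hXO.norm_left)
  exact Finset.single_le_sum (f := fun β => ‖(G x).col α β‖) (fun _ _ => norm_nonneg _)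
    (Finset.mem_univ β)

/-- The least squares solutions are `O(ε)`-close to the generating matrices of exact tensors at
distance at most `ε`. -/
lemma entryO_sub_of_isLeastSquares (hκ0 : 0 ≤ κ)
    (hκ : ∀ x, ∀ α ∈ B1 d r, ∀ g : B0 d r → ℂ,
      ∑ β, ‖g β‖ ^ 2 ≤ κ ^ 2 * ∑ γ, ‖(matA r (F x) α *ᵥ g) γ‖ ^ 2)
    (hGO : EntryO l G fun _ => 1) (hG : ∀ x, Generates (G x) (v x))
    (hε : ∀ x, ‖F x - scaledSum m (lam x) (v x)‖ ≤ ε x)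
    (hls : ∀ x, IsLeastSquares (F x) (Gls x)) :
    EntryO l (fun x => Gls x - G x) ε := by
  set X : ι → Tensor m d := fun x => scaledSum m (lam x) (v x) with hX
  have hFX : (fun x => F x - X x) =O[l] ε := IsBigO.of_norm_le hε
  have hres : ∀ (α : B1 d r) γ,
      (fun x => (matA r (F x) α.1 *ᵥ (G x).col α) γ - vecb (F x) α.1 γ) =O[l] ε := fun α γ => by
    have h1 : (fun x => ∑ β : B0 d r, entry (F x - X x) (β.1 + γ.1) * G x β α) =O[l] ε :=
      IsBigO.fun_sum fun β _ => by simpa using (isBigO_entry hFX _).mul (hGO β α)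
    refine (h1.sub (isBigO_entry hFX (α.1 + γ.1))).congr_left fun x => ?_
    have h2 := (hG x).matA_mulVec_col (lam x) α γ
    simp only [vecb, Matrix.mulVec, dotProduct, matA, Matrix.col_apply] at h2 ⊢
    simp only [entry_sub, sub_mul, Finset.sum_sub_distrib, hX, h2]
    ring
  have hobj : (fun x => lsObjective (F x) (G x)) =O[l] (fun x => ε x ^ 2) :=
    IsBigO.fun_sum fun α _ => IsBigO.fun_sum fun γ _ => (hres α γ).norm_left.pow 2
  have hres' : ∀ (α : B1 d r) γ,
      (fun x => (matA r (F x) α.1 *ᵥ (Gls x).col α) γ - vecb (F x) α.1 γ) =O[l] ε :=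
      fun α γ => by
    refine IsBigO.of_norm_left (IsBigO.of_pow (n := 2) two_ne_zero ?_)
    refine (IsBigO.of_norm_le fun x => ?_).trans hobj
    rw [Pi.pow_apply, Real.norm_of_nonneg (by positivity)]
    refine le_trans ?_ (hls x (G x))
    refine le_trans ?_ (Finset.single_le_sum
      (f := fun α : B1 d r => ∑ γ, ‖(matA r (F x) α.1 *ᵥ (Gls x).col α) γ - vecb (F x) α.1 γ‖ ^ 2)
      (fun _ _ => by positivity) (Finset.mem_univ α))
    exact Finset.single_le_sum
      (f := fun γ => ‖(matA r (F x) α.1 *ᵥ (Gls x).col α) γ - vecb (F x) α.1 γ‖ ^ 2)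
      (fun _ _ => by positivity) (Finset.mem_univ γ)
  refine entryO_of_isBigO_mulVec hκ0 hκ fun α γ => ?_
  refine ((hres' α γ).sub (hres α γ)).congr_left fun x => ?_
  have h1 : (Gls x - G x).col α = (Gls x).col α - (G x).col α := rfl
  rw [h1, Matrix.mulVec_sub, Pi.sub_apply]
  ring

lemma EntryO.companion (hG : EntryO l G fun _ => 1) (k : Fin d) :
    EntryO l (fun x => companion (G x) k) fun _ => 1 := fun μ ν => by
  by_cases hν : ν.1 + Pi.single k 1 ∈ B0 d r
  · simp only [LowRank.companion, hν, dite_true]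
    exact isBigO_const_const _ (one_ne_zero (α := ℝ)) _
  · simpa only [LowRank.companion, hν, dite_false] using hG _ _

lemma EntryO.companion_sub (hG : EntryO l (fun x => Gls x - G x) ε) (k : Fin d) :
    EntryO l (fun x => LowRank.companion (Gls x) k - LowRank.companion (G x) k) ε := fun μ ν => by
  by_cases hν : ν.1 + Pi.single k 1 ∈ B0 d r
  · simpa only [Matrix.sub_apply, LowRank.companion, hν, dite_true, sub_self] using isBigO_zero ε l
  · simpa only [Matrix.sub_apply, LowRank.companion, hν, dite_false] using
      hG μ ⟨_, shift_mem_B1 ν.2 k hν⟩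

end Perturbation

/-! ### Stability of the algorithm -/

section Stability

variable {m d r : ℕ}

/-- The eigenvalues of `L(ξ)` are the diagonal entries of its Schur form. -/
lemma Run.roots_charpoly {F : Tensor m d} (R : Run r F) :
    (matL R.G R.ξ).charpoly.roots = Finset.univ.val.map fun i => R.T i i := by
  have h1 : R.T.charpoly = (matL R.G R.ξ).charpoly := by
    have h2 := Matrix.charpoly_mul_comm' (R.Qᴴ * matL R.G R.ξ) R.Q
    rw [R.card_B0, Fintype.card_fin, R.schur, ← Matrix.mul_assoc, R.Q_unitary.2,
      Matrix.one_mul] at h2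
    exact mul_left_cancel₀ (pow_ne_zero _ Polynomial.X_ne_zero) h2
  rw [← h1, Matrix.charpoly_of_isUpperTriangular _ R.T_upper]
  have h3 := Polynomial.roots_multiset_prod_X_sub_C (Finset.univ.val.map fun i => R.T i i)
  rw [Multiset.map_map] at h3
  exact h3

lemma Run.injective_diag {F : Tensor m d} (R : Run r F) (h : R.NoRepeatedEigenvalue) :
    Function.Injective fun i => R.T i i := by
  rw [Run.NoRepeatedEigenvalue, R.roots_charpoly] at h
  exact fun i j hij =>
    Multiset.inj_on_of_nodup_map h i (Finset.mem_univ i) j (Finset.mem_univ j) hij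

/-- For a family of well-conditioned runs and exact tensors `X` at distance `ε → 0` from `F`, the
output of the algorithm is `O(ε)`-close to `F`. -/
theorem isBigO_sub_Xgp {ι : Type*} {l : Filter ι} {κ : ℝ} {F : ι → Tensor m d}
    {lam : ι → Fin r → ℂ} {v : ι → Fin r → Fin d → ℂ} {ε : ι → ℝ} (hκ0 : 0 ≤ κ)
    (hfull : ∀ x, FullColumnRank r (F x)) (hF : ∀ x, ‖F x‖ ≤ κ)
    (hκ : ∀ x, ∀ α ∈ B1 d r, ∀ g : B0 d r → ℂ,
      ∑ β, ‖g β‖ ^ 2 ≤ κ ^ 2 * ∑ γ, ‖(matA r (F x) α *ᵥ g) γ‖ ^ 2)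
    (R : ∀ x, Run r (F x)) (hR : ∀ x, (R x).NoRepeatedEigenvalue)
    (hgap : ∀ x, ∀ a ∈ (matL (R x).G (R x).ξ).charpoly.roots,
      ∀ b ∈ (matL (R x).G (R x).ξ).charpoly.roots, a ≠ b → 1 ≤ κ * ‖a - b‖)
    (hv : ∀ x, MonomialsIndependent (v x))
    (hε : ∀ x, ‖F x - scaledSum m (lam x) (v x)‖ ≤ ε x) (hε0 : Tendsto ε l (nhds 0)) :
    (fun x => F x - (R x).Xgp) =O[l] ε := by
  have hFX : (fun x => F x - scaledSum m (lam x) (v x)) =O[l] ε := IsBigO.of_norm_le hε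
  have hFO : F =O[l] (fun _ => (1 : ℝ)) :=
    IsBigO.of_bound κ (Eventually.of_forall fun x => by simpa using hF x)
  -- For `r = 0` both tensors are zero, and there is no monomial `1` in `𝔹₀`.
  rcases Nat.eq_zero_or_pos r with rfl | hr
  · refine hFX.congr_left fun x => ?_
    rw [(R x).Xgp_eq]
    simp [scaledSum]
  have hεO : ε =O[l] (fun _ => (1 : ℝ)) := hε0.isBigO_one ℝ
  choose G hG using fun x => exists_generates (hv x) (R x).card_B0
  have hGO : EntryO l G fun _ => 1 := entryO_of_generates hκ0 hκ hFO hG hε hε0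
  have hGsub : EntryO l (fun x => (R x).G - G x) ε :=
    entryO_sub_of_isLeastSquares hκ0 hκ hGO hG hε fun x => (R x).G_ls
  have hGls : EntryO l (fun x => (R x).G) fun _ => 1 := by
    simpa using (hGsub.trans hεO).add hGO
  have hξ : ∀ k, (fun x => (R x).ξ k) =O[l] (fun _ => (1 : ℝ)) := fun k =>
    IsBigO.of_bound 1 (Eventually.of_forall fun x => by
      have h := Finset.single_le_sum (f := fun k => ‖(R x).ξ k‖ ^ 2) (fun _ _ => by positivity)
        (Finset.mem_univ k)
      rw [(R x).ξ_unit] at h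
      simp only [norm_one, mul_one]
      nlinarith [norm_nonneg ((R x).ξ k)])
  have hinj := fun x => (R x).injective_diag (hR x)
  have hgapO : ∀ i j, i ≠ j →
      (fun x => ((R x).T i i - (R x).T j j)⁻¹) =O[l] (fun _ => (1 : ℝ)) := fun i j hij =>
    IsBigO.of_bound κ (Eventually.of_forall fun x => by
      have hne : (R x).T i i ≠ (R x).T j j := fun h => hij (hinj x h)
      have hpos : 0 < ‖(R x).T i i - (R x).T j j‖ := norm_pos_iff.mpr (sub_ne_zero.mpr hne)
      have h := hgap x _ (by rw [(R x).roots_charpoly]; simp) _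
        (by rw [(R x).roots_charpoly]; simp) hne
      rw [norm_inv, norm_one, mul_one]
      exact (inv_le_iff_one_le_mul₀ hpos).mpr h)
  obtain ⟨Z, Z', hZO, hZO', hZ'Z, hZZ', hdiag⟩ := exists_approx_diagonalization
    (M := fun x => companion (R x).G) (N := fun x => companion (G x)) (ξ := fun x => (R x).ξ)
    (Q := fun x => (R x).Q) (T := fun x => (R x).T) (fun k => hGls.companion k)
    (fun k => hGsub.companion_sub k) (fun k => hGO.companion k)
    (fun x k k' => (hG x).companion_comm (hv x) (R x).card_B0 k k') hξ
    (fun x => (R x).Q_unitary) (fun x => (R x).schur) (fun x => (R x).T_upper) hinj hgapO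
  -- The approximate diagonalization extends to the multiplication by `x_0 = 1`.
  set S : ι → Fin (d + 1) → Matrix (Fin r) (Fin r) ℂ :=
    fun x k => Z' x * homogCompanion (G x) k * Z x with hS
  have hSdiag : ∀ k, EntryO l (fun x => S x k -
      Matrix.diagonal fun s => homog ((R x).v s) k) ε := fun k => by
    refine Fin.cases ?_ (fun k => ?_) k
    · intro i j
      simpa [hS, homogCompanion, homog, hZ'Z] using isBigO_zero ε l
    · simpa [hS, homogCompanion, homog, (R _).v_eq] using hdiag k
  have hSO : ∀ k, EntryO l (fun x => S x k) fun _ => 1 := fun k => by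
    have h1 : EntryO l (fun x => homogCompanion (G x) k) fun _ => 1 := by
      refine Fin.cases ?_ (fun k => ?_) k
      · simpa [homogCompanion] using entryO_one
      · simpa [homogCompanion] using hGO.companion k
    exact (hZO'.mul_bounded h1).mul_bounded hZO
  have hwO : ∀ k i, (fun x => homog ((R x).v i) k) =O[l] (fun _ => (1 : ℝ)) := fun k i => by
    have h1 := ((hSO k).sub ((hSdiag k).trans hεO)) i i
    simpa using h1
  -- The row vector that represents `X` on `𝔹₀`.
  set f : ι → Matrix Unit (B0 d r) ℂ :=
    fun x => Matrix.replicateRow Unit (lam x ᵥ* vandermondeB0 (v x)) with hf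
  have hfO : EntryO l f fun _ => 1 := fun _ β => by
    have hXO : (fun x => scaledSum m (lam x) (v x)) =O[l] (fun _ => (1 : ℝ)) := by
      simpa using hFO.sub (hFX.trans hεO)
    refine (isBigO_entry hXO β.1).congr_left fun x => ?_
    rw [entry_scaledSum _ _ (deg_le_of_mem_B0 (hfull x) (R x).pos_of_run hr β.2)]
    simp [hf, Matrix.vecMul, dotProduct, vandermondeB0]
  -- The coefficients read off from the approximate diagonalization. Optimality of `R.lam` makes it
  -- enough to approximate `F` with some coefficients.
  let o : B0 d r := ⟨0, zero_mem_B0 hr⟩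
  set lam' : ι → Fin r → ℂ := fun x s => (f x * Z x) () s * Z' x s o with hlam'
  have hX : (fun x => scaledSum m (lam x) (v x) - scaledSum m (lam' x) (R x).v) =O[l] ε := by
    have hi : ∀ i : Fin m → Fin (d + 1), (fun x => (scaledSum m (lam x) (v x) -
        scaledSum m (lam' x) (R x).v) i) =O[l] ε := fun i => by
      have h1 := entryO_list_prod_sub_diagonal hSO (w := fun x k s => homog ((R x).v s) k)
        hwO hSdiag (List.ofFn i)
      have h2 := ((hfO.mul_bounded hZO).bounded_mul (h1.mul_bounded hZO')) () o
      refine h2.congr_left fun x => ?_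
      have h3 : ∀ L : List (Fin (d + 1)), (L.map (S x)).prod =
          Z' x * (L.map (homogCompanion (G x))).prod * Z x := fun L => by
        induction L with
        | nil => simp [hZ'Z]
        | cons k L ih =>
          rw [List.map_cons, List.prod_cons, ih, List.map_cons, List.prod_cons, hS]
          calc _ = Z' x * homogCompanion (G x) k * (Z x * Z' x) *
                (L.map (homogCompanion (G x))).prod * Z x := by simp only [Matrix.mul_assoc]
            _ = _ := by rw [hZZ', Matrix.mul_one]; simp only [Matrix.mul_assoc]
      have h4 : f x * Z x * ((Z' x * ((List.ofFn i).map (homogCompanion (G x))).prod * Z x) *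
          Z' x) = f x * ((List.ofFn i).map (homogCompanion (G x))).prod := by
        calc _ = f x * (Z x * Z' x) * ((List.ofFn i).map (homogCompanion (G x))).prod *
              (Z x * Z' x) := by simp only [Matrix.mul_assoc]
          _ = _ := by rw [hZZ', Matrix.mul_one, Matrix.mul_one]
      have h5 : (f x * Z x * (Matrix.diagonal (fun s =>
          ((List.ofFn i).map fun k => homog ((R x).v s) k).prod) * Z' x)) () o =
          scaledSum m (lam' x) (R x).v i := by
        rw [scaledSum_apply, Matrix.mul_apply]
        refine Finset.sum_congr rfl fun s _ => ?_
        rw [Matrix.diagonal_mul, List.map_ofFn, List.prod_ofFn, hlam']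
        simp only [Function.comp_apply]
        ring
      beta_reduce
      rw [Matrix.sub_mul, Matrix.mul_sub, Matrix.sub_apply, h3, h4, h5, PiLp.sub_apply,
        (hG x).scaledSum_apply_eq hr]
    refine (IsBigO.of_norm_le fun x => ?_).trans
      (IsBigO.fun_sum (s := Finset.univ) fun i _ => (hi i).norm_left)
    rw [EuclideanSpace.norm_eq]
    refine Real.sqrt_le_iff.mpr ⟨Finset.sum_nonneg fun _ _ => norm_nonneg _, ?_⟩
    exact Finset.sum_sq_le_sq_sum_of_nonneg fun _ _ => norm_nonneg _
  refine (IsBigO.of_norm_le fun x => (R x).norm_sub_Xgp_le (lam' x)).trans ?_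
  refine ((hFX.add hX).congr_left fun x => ?_).norm_left
  abel

/-- Under full column rank, the matrices `A[F, α]` are uniformly bounded below. -/
lemma FullColumnRank.exists_lower_bound {F : Tensor m d} (hF : FullColumnRank r F) :
    ∃ K > (0 : ℝ), ∀ κ ≥ K, ∀ α ∈ B1 d r, ∀ g : B0 d r → ℂ,
      ∑ β, ‖g β‖ ^ 2 ≤ κ ^ 2 * ∑ γ, ‖(matA r F α *ᵥ g) γ‖ ^ 2 := by
  have h1 : ∀ α : B1 d r, ∃ K > (0 : ℝ), ∀ g : B0 d r → ℂ,
      ∑ β, ‖g β‖ ^ 2 ≤ K ^ 2 * ∑ γ, ‖(matA r F α.1 *ᵥ g) γ‖ ^ 2 := fun α => by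
    let A := (Matrix.toLpLin 2 2 (matA r F α.1)).toContinuousLinearMap
    have hinj : Function.Injective A := fun g g' h => by
      have h2 := Matrix.mulVec_injective_iff.mpr (hF α.1 α.2)
      exact WithLp.ofLp_injective 2 (h2 (congrArg WithLp.ofLp h))
    obtain ⟨K, hK, hA⟩ := A.exists_antilipschitzWith (LinearMap.ker_eq_bot.mpr hinj)
    refine ⟨K, hK, fun g => ?_⟩
    have h3 := hA.le_mul_norm (map_zero A) (WithLp.toLp 2 g)
    have h4 := pow_le_pow_left₀ (norm_nonneg _) h3 2
    rw [mul_pow, EuclideanSpace.norm_sq_eq, EuclideanSpace.norm_sq_eq] at h4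
    exact h4
  choose K hK hbound using h1
  refine ⟨1 + ∑ α, K α, ?_, fun κ hκ α hα g => (hbound ⟨α, hα⟩ g).trans ?_⟩
  · have := Finset.sum_nonneg fun α (_ : α ∈ Finset.univ) => (hK α).le
    positivity
  · have h2 := Finset.single_le_sum (f := K) (fun α _ => (hK α).le) (Finset.mem_univ ⟨α, hα⟩)
    have h3 := (hK ⟨α, hα⟩).le
    gcongr
    linarith

/-- The bounds with constants that are uniform over well-conditioned data. -/
theorem exists_uniform_bound (m d r : ℕ) (κ : ℝ) (hκ : 0 < κ) :
    ∃ δ > (0 : ℝ), ∃ C > (0 : ℝ),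
      ∀ F : Tensor m d, IsSymmetric F → FullColumnRank r F →
        ‖F‖ ≤ κ →
        (∀ α ∈ B1 d r, ∀ g : B0 d r → ℂ,
          ∑ β, ‖g β‖ ^ 2 ≤ κ ^ 2 * ∑ γ, ‖(matA r F α *ᵥ g) γ‖ ^ 2) →
        ∀ R : Run r F, R.NoRepeatedEigenvalue →
        (∀ a ∈ (matL R.G R.ξ).charpoly.roots, ∀ b ∈ (matL R.G R.ξ).charpoly.roots,
          a ≠ b → 1 ≤ κ * ‖a - b‖) →
        ∀ u : Fin r → Fin (d + 1) → ℂ, (∀ i, u i 0 ≠ 0) →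
          MonomialsIndependent (dehomog u) → ScalingOptimal F u →
          ‖F - waring m u‖ ≤ δ →
            ‖waring m u - R.Xgp‖ ≤ C * ‖F - waring m u‖ ∧
            ‖F - R.Xopt‖ ≤ ‖F - R.Xgp‖ ∧
            ‖F - R.Xgp‖ ≤ C * ‖F - waring m u‖ := by
  -- All admissible data, filtered by the size of the approximation error.
  let Ω := {p : Σ F : Tensor m d, Run r F × (Fin r → Fin (d + 1) → ℂ) //
    FullColumnRank r p.1 ∧ ‖p.1‖ ≤ κ ∧
    (∀ α ∈ B1 d r, ∀ g : B0 d r → ℂ,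
      ∑ β, ‖g β‖ ^ 2 ≤ κ ^ 2 * ∑ γ, ‖(matA r p.1 α *ᵥ g) γ‖ ^ 2) ∧
    p.2.1.NoRepeatedEigenvalue ∧
    (∀ a ∈ (matL p.2.1.G p.2.1.ξ).charpoly.roots,
      ∀ b ∈ (matL p.2.1.G p.2.1.ξ).charpoly.roots, a ≠ b → 1 ≤ κ * ‖a - b‖) ∧
    (∀ i, p.2.2 i 0 ≠ 0) ∧ MonomialsIndependent (dehomog p.2.2)}
  let ε : Ω → ℝ := fun x => ‖x.1.1 - waring m x.1.2.2‖
  have hO := isBigO_sub_Xgp (l := Filter.comap ε (nhds 0)) (F := fun x : Ω => x.1.1)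
    (lam := fun x => scaling m x.1.2.2) (v := fun x => dehomog x.1.2.2) (ε := ε) hκ.le
    (fun x => x.2.1) (fun x => x.2.2.1) (fun x => x.2.2.2.1) (fun x => x.1.2.1)
    (fun x => x.2.2.2.2.1) (fun x => x.2.2.2.2.2.1) (fun x => x.2.2.2.2.2.2.2)
    (fun x => by rw [← waring_eq_scaledSum _ x.2.2.2.2.2.2.1]) Filter.tendsto_comap
  obtain ⟨C, hC, hbound⟩ := hO.exists_pos
  rw [Asymptotics.isBigOWith_iff, Filter.eventually_comap, Metric.eventually_nhds_iff]
    at hbound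
  obtain ⟨δ, hδ, hbound⟩ := hbound
  refine ⟨δ / 2, half_pos hδ, 1 + C, by positivity,
    fun F _ hF hFκ hA R hR hgap u hu0 hu1 _ hε => ?_⟩
  have h1 : ‖F - R.Xgp‖ ≤ C * ‖F - waring m u‖ := by
    have h2 := hbound (y := ‖F - waring m u‖) (by
      rw [dist_zero_right, norm_norm]; linarith)
      ⟨⟨F, R, u⟩, hF, hFκ, hA, hR, hgap, hu0, hu1⟩ rfl
    simpa [ε] using h2
  have h3 : ‖waring m u - R.Xgp‖ ≤ ‖F - waring m u‖ + ‖F - R.Xgp‖ := by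
    rw [norm_sub_rev F (waring m u)]
    exact norm_sub_le_norm_sub_add_norm_sub _ _ _
  have h4 := norm_nonneg (F - waring m u)
  exact ⟨by linarith, R.norm_sub_Xopt_le, by linarith⟩

/-- The bounds for a fixed tensor. If there are admissible exact tensors arbitrarily close to `F`,
then the uniform estimate makes every run exact, and otherwise there is nothing to show once `δ` is
small. -/
theorem exists_bound {m d r : ℕ} (F : Tensor m d) (hsym : IsSymmetric F)
    (hF : FullColumnRank r F) :
    ∃ δ > (0 : ℝ), ∃ C > (0 : ℝ),
      ∀ R : Run r F, R.NoRepeatedEigenvalue →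
      ∀ u : Fin r → Fin (d + 1) → ℂ, (∀ i, u i 0 ≠ 0) →
        MonomialsIndependent (dehomog u) → ScalingOptimal F u →
        ‖F - waring m u‖ ≤ δ →
          ‖waring m u - R.Xgp‖ ≤ C * ‖F - waring m u‖ ∧
          ‖F - R.Xopt‖ ≤ ‖F - R.Xgp‖ ∧
          ‖F - R.Xgp‖ ≤ C * ‖F - waring m u‖ := by
  by_cases hex : ∀ δ > (0 : ℝ), ∃ u : Fin r → Fin (d + 1) → ℂ, (∀ i, u i 0 ≠ 0) ∧
    MonomialsIndependent (dehomog u) ∧ ScalingOptimal F u ∧ ‖F - waring m u‖ ≤ δ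
  · -- The uniform estimate, applied to each run along exact tensors that converge to `F`, shows
    -- that every run recovers `F` exactly.
    have hzero : ∀ R : Run r F, R.NoRepeatedEigenvalue → F = R.Xgp := fun R hR => by
      obtain ⟨K, hK, hbound⟩ := hF.exists_lower_bound
      set ρ := (matL R.G R.ξ).charpoly.roots.toFinset
      set κ : ℝ := K + ‖F‖ + ∑ a ∈ ρ, ∑ b ∈ ρ, ‖a - b‖⁻¹ with hκ
      have hsum : 0 ≤ ∑ a ∈ ρ, ∑ b ∈ ρ, ‖a - b‖⁻¹ :=
        Finset.sum_nonneg fun _ _ => Finset.sum_nonneg fun _ _ => by positivity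
      have hFn := norm_nonneg F
      obtain ⟨δ, hδ, C, hC, h⟩ := exists_uniform_bound m d r κ (by positivity)
      have h' := h F hsym hF (by linarith) (hbound κ (by rw [ge_iff_le]; linarith)) R hR
        (fun a ha b hb hab => by
          have hpos : 0 < ‖a - b‖ := norm_pos_iff.mpr (sub_ne_zero.mpr hab)
          rw [← inv_le_iff_one_le_mul₀ hpos]
          have h1 := Finset.single_le_sum (f := fun b => ‖a - b‖⁻¹)
            (fun _ _ => by positivity) (Multiset.mem_toFinset.mpr hb)
          have h2 := Finset.single_le_sum (f := fun a => ∑ b ∈ ρ, ‖a - b‖⁻¹)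
            (fun _ _ => Finset.sum_nonneg fun _ _ => by positivity)
            (Multiset.mem_toFinset.mpr ha)
          linarith)
      have h0 : ‖F - R.Xgp‖ ≤ 0 := le_of_forall_pos_le_add fun η hη => by
        obtain ⟨u, hu0, hu1, hu2, hu3⟩ := hex (min δ (η / C)) (by positivity)
        have h1 := (h' u hu0 hu1 hu2 (hu3.trans (min_le_left _ _))).2.2
        have h2 := mul_le_mul_of_nonneg_left (hu3.trans (min_le_right _ _)) hC.le
        rw [mul_div_cancel₀ _ hC.ne'] at h2
        linarith
      exact sub_eq_zero.mp (norm_le_zero_iff.mp h0)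
    refine ⟨1, one_pos, 1, one_pos, fun R hR u _ _ _ _ => ⟨?_, R.norm_sub_Xopt_le, ?_⟩⟩
    · rw [← hzero R hR, norm_sub_rev, one_mul]
    · rw [← hzero R hR, sub_self, norm_zero]
      positivity
  · push Not at hex
    obtain ⟨δ, hδ, h⟩ := hex
    exact ⟨δ, hδ, 1, one_pos, fun R hR u h0 h1 h2 h3 =>
      absurd h3 (not_le.mpr (h u h0 h1 h2))⟩

end Stability

end LowRank

end

open LowRank in
theorem mainTheorem1 (m d r : ℕ) (hm : 0 < m) :
    (∀ F : Tensor m d, IsSymmetric F → FullColumnRank r F →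
      ∃ δ > (0 : ℝ), ∃ C > (0 : ℝ),
        ∀ R : Run r F, R.NoRepeatedEigenvalue →
        ∀ u : Fin r → Fin (d + 1) → ℂ, (∀ i, u i 0 ≠ 0) →
          MonomialsIndependent (dehomog u) → ScalingOptimal F u →
          ‖F - waring m u‖ ≤ δ →
            ‖waring m u - R.Xgp‖ ≤ C * ‖F - waring m u‖ ∧
            ‖F - R.Xopt‖ ≤ ‖F - R.Xgp‖ ∧
            ‖F - R.Xgp‖ ≤ C * ‖F - waring m u‖) ∧
    (∀ κ > (0 : ℝ), ∃ δ > (0 : ℝ), ∃ C > (0 : ℝ),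
      ∀ F : Tensor m d, IsSymmetric F → FullColumnRank r F →
        ‖F‖ ≤ κ →
        (∀ α ∈ B1 d r, ∀ g : B0 d r → ℂ,
          ∑ β, ‖g β‖ ^ 2 ≤ κ ^ 2 * ∑ γ, ‖(matA r F α *ᵥ g) γ‖ ^ 2) →
        ∀ R : Run r F, R.NoRepeatedEigenvalue →
        (∀ a ∈ (matL R.G R.ξ).charpoly.roots, ∀ b ∈ (matL R.G R.ξ).charpoly.roots,
          a ≠ b → 1 ≤ κ * ‖a - b‖) →
        ∀ u : Fin r → Fin (d + 1) → ℂ, (∀ i, u i 0 ≠ 0) →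
          MonomialsIndependent (dehomog u) → ScalingOptimal F u →
          ‖F - waring m u‖ ≤ δ →
            ‖waring m u - R.Xgp‖ ≤ C * ‖F - waring m u‖ ∧
            ‖F - R.Xopt‖ ≤ ‖F - R.Xgp‖ ∧
            ‖F - R.Xgp‖ ≤ C * ‖F - waring m u‖) :=
  ⟨fun F hsym hF => exists_bound F hsym hF, fun κ hκ => exists_uniform_bound m d r κ hκ⟩
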